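/- Fix integers $p,k\ge 0$ and $m_i,q_i\ge 0$ for $i=1,\dots,k$. Consider the additive growth curve model $$Y_n=\sum_{i=1}^k X_i\Theta_iZ_i'+\mathcal E_n ,\qquad n=1,2,\dots,$$ where: - $Z_i\in\mathbb R^{p\times q_i}$ is a fixed matrix with $\operatorname{rank}(Z_i)=q_i$, and $\Theta_i\in\mathbb R^{m_i\times q_i}$ is a fixed coefficient matrix; - $X_i=X_i^{(n)}\in\mathbb R^{n\times m_i}$ is a non-random design matrix consisting of the first $n$ rows of a fixed infinite array (so increasing $n$ by one adds one row and leaves the earlier rows intact); for all sufficiently large $n$, $\operatorname{rank}(X_i)+p\le n$ for every $i$ and $X_i'X_j=0$ for all $i\ne j$; - the rows of $\mathcal E_n\in\mathbb R^{n\times p}$ are the first $n$ terms of a sequence of independent, identically distributed random vectors in $\mathbb R^p$ with finite second moments, mean zero and positive definite covariance matrix $\Sigma$. Let $P_X$ denote the orthogonal projection onto the column space of $X$ and put $$\widehat\Sigma(Y)=Y'\,\frac1r\Bigl(I-\sum_{i=1}^kP_{X_i}\Bigr)Y,\quad r=n-\sum_{i=1}^k\operatorname{rank}(X_i),\qquad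 H_i(Y)=\widehat\Sigma^{-1}(Y)Z_i\bigl(Z_i'\widehat\Sigma^{-1}(Y)Z_i\bigr)^{-1}Z_i',$$ and let $$\widehat\Theta_i(Y)=(X_i'X_i)^{-1}X_i'\,Y\,H_i(Y)\,Z_i(Z_i'Z_i)^{-1}$$ be the two-stage generalized least-squares estimator of $\Theta_i$. (The inverse of a singular matrix is read as $0$; the probability that a singular matrix is inverted here tends to $0$ as $n\to\infty$.) Assume that for every $l=1,\dots,k$, $\lim_{n\to\infty}n^{-1}X_l'X_l=R_l$ with $R_l$ positive definite. Then for every $i\in\{1,\dots,k\}$, as $n\to\infty$, $$\sqrt n\,\bigl[\widehat\Theta_i(Y_n)-\Theta_i\bigr]\ \longrightarrow\ \mathcal N_{m_i\times q_i}\bigl(0,\;R_i^{-1}\otimes(Z_i'\Sigma^{-1}Z_i)^{-1}\bigr)\quad\text{in distribution.}$$ Here $\mathcal N_{m\times q}(0,A\otimes B)$ is the law of a random $m\times q$ matrix whose vectorization $\operatorname{vec}$, obtained by stacking the rows one underneath another, is Gaussian with mean $0$ and covariance matrix $A\otimes B=(a_{ij}B)$. -/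

import Mathlib

open MeasureTheory ProbabilityTheory Filter Topology Matrix
open scoped Kronecker

namespace GrowthCurve

/-- The `n × d` matrix formed by the first `n` rows of an infinite array of rows. Passing from `n`
to `n + 1` adds one row and leaves the earlier rows intact. -/
def firstRows {d : ℕ} (x : ℕ → Fin d → ℝ) (n : ℕ) : Matrix (Fin n) (Fin d) ℝ :=
  Matrix.of fun j => x j

/-- The matrix `P_X` of the orthogonal projection of `ℝⁿ` onto the column space of `X`. -/
noncomputable def projCol {n d : ℕ} (X : Matrix (Fin n) (Fin d) ℝ) : Matrix (Fin n) (Fin n) ℝ :=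
  Matrix.toEuclideanLin.symm
    ((LinearMap.range (Matrix.toEuclideanLin X)).starProjection :
      EuclideanSpace ℝ (Fin n) →ₗ[ℝ] EuclideanSpace ℝ (Fin n))

/-- The design condition: `rank X_i + p ≤ n`, and the column spaces are mutually orthogonal. -/
structure OrthogonalDesign {n k : ℕ} {m : Fin k → ℕ} (p : ℕ)
    (X : ∀ i, Matrix (Fin n) (Fin (m i)) ℝ) : Prop where
  rank_add_le : ∀ i, (X i).rank + p ≤ n
  orthogonal : ∀ i j, i ≠ j → (X i)ᵀ * X j = 0

/-- The mean structure `∑ i, X_i Θ_i Z_i'`. -/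
noncomputable def meanStructure {n p k : ℕ} {m q : Fin k → ℕ}
    (X : ∀ i, Matrix (Fin n) (Fin (m i)) ℝ) (Z : ∀ i, Matrix (Fin p) (Fin (q i)) ℝ)
    (Θ : ∀ i, Matrix (Fin (m i)) (Fin (q i)) ℝ) : Matrix (Fin n) (Fin p) ℝ :=
  ∑ i, X i * Θ i * (Z i)ᵀ

/-- The quadratic estimator `Y' W Y` of the covariance matrix, where
`W = r⁻¹ (I - ∑ i, P_{X_i})` and `r = n - ∑ i, rank X_i`. -/
noncomputable def sigmaHat {n p k : ℕ} {m : Fin k → ℕ}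
    (X : ∀ i, Matrix (Fin n) (Fin (m i)) ℝ) (Y : Matrix (Fin n) (Fin p) ℝ) :
    Matrix (Fin p) (Fin p) ℝ :=
  Yᵀ * (((n : ℝ) - ∑ i, ((X i).rank : ℝ))⁻¹ • (1 - ∑ i, projCol (X i))) * Y

/-- `S⁻¹ Z (Z' S⁻¹ Z)⁻¹ Z'`. -/
noncomputable def weightMatrix {p d : ℕ} (S : Matrix (Fin p) (Fin p) ℝ)
    (Z : Matrix (Fin p) (Fin d) ℝ) : Matrix (Fin p) (Fin p) ℝ :=
  S⁻¹ * Z * (Zᵀ * S⁻¹ * Z)⁻¹ * Zᵀ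

/-- The two-stage generalized least-squares estimator of `Θ_i`,
`(X_i' X_i)⁻¹ X_i' Y H_i(Y) Z_i (Z_i' Z_i)⁻¹`. -/
noncomputable def thetaHat {n p k : ℕ} {m q : Fin k → ℕ}
    (X : ∀ i, Matrix (Fin n) (Fin (m i)) ℝ) (Z : ∀ i, Matrix (Fin p) (Fin (q i)) ℝ)
    (Y : Matrix (Fin n) (Fin p) ℝ) (i : Fin k) : Matrix (Fin (m i)) (Fin (q i)) ℝ :=
  ((X i)ᵀ * X i)⁻¹ * (X i)ᵀ * Y * weightMatrix (sigmaHat X Y) (Z i) * Z i * ((Z i)ᵀ * Z i)⁻¹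

/-- The generalized least-squares criterion `⟨Y - μ, Y - μ⟩ = vec(Y - μ)' (I ⊗ S)⁻¹ vec(Y - μ)`,
written as a trace, at the mean structure `μ` with coefficients `Θ`. -/
noncomputable def glsCriterion {n p k : ℕ} {m q : Fin k → ℕ}
    (X : ∀ i, Matrix (Fin n) (Fin (m i)) ℝ) (Z : ∀ i, Matrix (Fin p) (Fin (q i)) ℝ)
    (S : Matrix (Fin p) (Fin p) ℝ) (Y : Matrix (Fin n) (Fin p) ℝ)
    (Θ : ∀ i, Matrix (Fin (m i)) (Fin (q i)) ℝ) : ℝ :=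
  ((Y - meanStructure X Z Θ) * S⁻¹ * (Y - meanStructure X Z Θ)ᵀ).trace

/-- The matrix `M` as a vector, its rows stacked one underneath another. -/
def rowVec {a b : ℕ} (M : Matrix (Fin a) (Fin b) ℝ) : EuclideanSpace ℝ (Fin a × Fin b) :=
  WithLp.toLp 2 fun ij => M ij.1 ij.2

/-- The law of `vec V` for a random `a × b` matrix `V` with the centred matrix normal law
`N_{a × b}(0, A ⊗ B)`: the Gaussian law with mean `0` and covariance matrix `A ⊗ B`. -/
noncomputable def matrixNormal {a b : ℕ} (A : Matrix (Fin a) (Fin a) ℝ)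
    (B : Matrix (Fin b) (Fin b) ℝ) : Measure (EuclideanSpace ℝ (Fin a × Fin b)) :=
  multivariateGaussian 0 (A ⊗ₖ B)

instance {a b : ℕ} (A : Matrix (Fin a) (Fin a) ℝ) (B : Matrix (Fin b) (Fin b) ℝ) :
    IsProbabilityMeasure (matrixNormal A B) := by
  unfold matrixNormal; infer_instance

lemma isUnit_gram {a b : ℕ} {A : Matrix (Fin a) (Fin b) ℝ} (h : A.rank = b)
    {M : Matrix (Fin a) (Fin a) ℝ} (hM : M.PosDef) : IsUnit (Aᵀ * M * A).det := by
  have hinj : Function.Injective A.mulVec := by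
    rw [Matrix.mulVec_injective_iff]
    rw [linearIndependent_iff_card_eq_finrank_span, Set.finrank,
      ← Matrix.rank_eq_finrank_span_cols, h, Fintype.card_fin]
  have := hM.conjTranspose_mul_mul_same (B := A) hinj
  rw [Matrix.conjTranspose_eq_transpose_of_trivial] at this
  exact (Matrix.isUnit_iff_isUnit_det _).1 this.isUnit

lemma isUnit_gram_one {a b : ℕ} {A : Matrix (Fin a) (Fin b) ℝ} (h : A.rank = b) :
    IsUnit (Aᵀ * A).det := by
  simpa using isUnit_gram h Matrix.PosDef.one

/-- The explicit estimator is the two-stage generalized least-squares estimator: with the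
first-stage estimator `sigmaHat X Y` in place of the covariance matrix, it is the unique minimizer
of the generalized least-squares criterion. -/
theorem isMinOn_glsCriterion_iff {n p k : ℕ} {m q : Fin k → ℕ}
    {X : ∀ i, Matrix (Fin n) (Fin (m i)) ℝ} {Z : ∀ i, Matrix (Fin p) (Fin (q i)) ℝ}
    (hX : ∀ i, (X i).rank = m i) (hZ : ∀ i, (Z i).rank = q i) (hO : OrthogonalDesign p X)
    (Y : Matrix (Fin n) (Fin p) ℝ) (hS : (sigmaHat X Y).PosDef)
    (Θ : ∀ i, Matrix (Fin (m i)) (Fin (q i)) ℝ) :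
    IsMinOn (glsCriterion X Z (sigmaHat X Y) Y) Set.univ Θ ↔ Θ = thetaHat X Z Y := by
  set S := sigmaHat X Y with hSdef
  have hM : (S⁻¹).PosDef := hS.inv
  have hMt : (S⁻¹)ᵀ = S⁻¹ := by
    simpa [Matrix.conjTranspose_eq_transpose_of_trivial] using hM.isHermitian.eq
  -- the normal equations
  have hK : ∀ i, weightMatrix S (Z i) * Z i * ((Z i)ᵀ * Z i)⁻¹ =
      S⁻¹ * Z i * ((Z i)ᵀ * S⁻¹ * Z i)⁻¹ := by
    intro i
    unfold weightMatrix
    rw [Matrix.mul_assoc _ (Z i)ᵀ, Matrix.mul_assoc _ ((Z i)ᵀ * Z i),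
      Matrix.mul_nonsing_inv _ (isUnit_gram_one (hZ i)), Matrix.mul_one]
  have hXm : ∀ (Δ : ∀ i, Matrix (Fin (m i)) (Fin (q i)) ℝ) i,
      (X i)ᵀ * meanStructure X Z Δ = (X i)ᵀ * X i * Δ i * (Z i)ᵀ := by
    intro Δ i
    unfold meanStructure
    rw [Matrix.mul_sum, Finset.sum_eq_single i]
    · simp only [Matrix.mul_assoc]
    · intro j _ hj
      simp only [← Matrix.mul_assoc]
      rw [hO.orthogonal i j hj.symm]
      simp
    · simp
  have hnormal : ∀ i, (X i)ᵀ * (Y - meanStructure X Z (thetaHat X Z Y)) * S⁻¹ * Z i = 0 := by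
    intro i
    rw [Matrix.mul_sub, hXm, Matrix.sub_mul, Matrix.sub_mul, sub_eq_zero]
    have e : (X i)ᵀ * X i * thetaHat X Z Y i =
        (X i)ᵀ * Y * (S⁻¹ * Z i * ((Z i)ᵀ * S⁻¹ * Z i)⁻¹) := by
      rw [← hK]
      unfold thetaHat
      simp only [← hSdef, ← Matrix.mul_assoc]
      rw [Matrix.mul_nonsing_inv _ (isUnit_gram_one (hX i)), Matrix.one_mul]
    rw [e]
    have : (X i)ᵀ * Y * (S⁻¹ * Z i * ((Z i)ᵀ * S⁻¹ * Z i)⁻¹) * (Z i)ᵀ * S⁻¹ * Z i =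
        (X i)ᵀ * Y * (S⁻¹ * Z i * (((Z i)ᵀ * S⁻¹ * Z i)⁻¹ * ((Z i)ᵀ * S⁻¹ * Z i))) := by
      simp only [Matrix.mul_assoc]
    rw [this, Matrix.nonsing_inv_mul _ (isUnit_gram (hZ i) hM), Matrix.mul_one]
    simp only [Matrix.mul_assoc]
  set D := Y - meanStructure X Z (thetaHat X Z Y) with hD
  have hcross : ∀ Δ : ∀ i, Matrix (Fin (m i)) (Fin (q i)) ℝ,
      (D * S⁻¹ * (meanStructure X Z Δ)ᵀ).trace = 0 := by
    intro Δ
    unfold meanStructure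
    rw [Matrix.transpose_sum, Matrix.mul_sum, Matrix.trace_sum]
    refine Finset.sum_eq_zero fun i _ => ?_
    have : D * S⁻¹ * (X i * Δ i * (Z i)ᵀ)ᵀ = D * S⁻¹ * Z i * (Δ i)ᵀ * (X i)ᵀ := by
      simp only [Matrix.transpose_mul, Matrix.transpose_transpose, Matrix.mul_assoc]
    rw [this, Matrix.trace_mul_comm]
    simp only [← Matrix.mul_assoc]
    rw [hnormal i]
    simp
  have hsplit : ∀ Δ : ∀ i, Matrix (Fin (m i)) (Fin (q i)) ℝ,
      glsCriterion X Z S Y (thetaHat X Z Y - Δ) = glsCriterion X Z S Y (thetaHat X Z Y) +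
        (meanStructure X Z Δ * S⁻¹ * (meanStructure X Z Δ)ᵀ).trace := by
    intro Δ
    have h1 : Y - meanStructure X Z (thetaHat X Z Y - Δ) = D + meanStructure X Z Δ := by
      rw [hD]
      unfold meanStructure
      simp only [Pi.sub_apply, Matrix.mul_sub, Matrix.sub_mul, Finset.sum_sub_distrib]
      abel
    have h2 : (meanStructure X Z Δ * S⁻¹ * Dᵀ).trace = 0 := by
      rw [← Matrix.trace_transpose, Matrix.transpose_mul, Matrix.transpose_mul,
        Matrix.transpose_transpose, hMt, ← Matrix.mul_assoc]
      exact hcross Δ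
    unfold glsCriterion
    rw [h1, ← hD, Matrix.transpose_add, Matrix.add_mul, Matrix.add_mul, Matrix.mul_add,
      Matrix.mul_add]
    simp only [Matrix.trace_add, hcross Δ, h2]
    ring
  have hpsd : ∀ B : Matrix (Fin n) (Fin p) ℝ, (B * S⁻¹ * Bᵀ).PosSemidef := by
    intro B
    simpa [Matrix.conjTranspose_eq_transpose_of_trivial] using
      hM.posSemidef.mul_mul_conjTranspose_same B
  constructor
  · intro hmin
    set Δ := thetaHat X Z Y - Θ with hΔ
    have hle : glsCriterion X Z S Y Θ ≤ glsCriterion X Z S Y (thetaHat X Z Y) :=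
      hmin (Set.mem_univ _)
    have hs := hsplit Δ
    rw [hΔ, sub_sub_cancel, ← hΔ] at hs
    set B := meanStructure X Z Δ with hB
    have h0 : (B * S⁻¹ * Bᵀ).trace = 0 :=
      le_antisymm (by linarith) (hpsd B).trace_nonneg
    have h1 : B * S⁻¹ * Bᵀ = 0 := (hpsd B).trace_eq_zero_iff.1 h0
    have h2 : B = 0 := by
      ext a b
      by_contra hne
      have hv : B a ≠ 0 := fun h => hne (by simp [h])
      have := hM.dotProduct_mulVec_pos hv
      have h3 : (B * S⁻¹ * Bᵀ) a a = star (B a) ⬝ᵥ (S⁻¹ *ᵥ B a) := by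
        rw [Matrix.mul_assoc]
        simp [Matrix.mul_apply, dotProduct, Matrix.mulVec]
      rw [h1] at h3
      simp only [Matrix.zero_apply] at h3
      linarith
    have h4 : Δ = 0 := by
      funext i
      have h5 : (X i)ᵀ * X i * Δ i * ((Z i)ᵀ * Z i) = 0 := by
        rw [← Matrix.mul_assoc, ← hXm, ← hB, h2]
        simp
      have h6 : ((X i)ᵀ * X i)⁻¹ * ((X i)ᵀ * X i) * Δ i *
          (((Z i)ᵀ * Z i) * ((Z i)ᵀ * Z i)⁻¹) =
          ((X i)ᵀ * X i)⁻¹ * ((X i)ᵀ * X i * Δ i * ((Z i)ᵀ * Z i)) * ((Z i)ᵀ * Z i)⁻¹ := by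
        simp only [Matrix.mul_assoc]
      rw [h5, Matrix.nonsing_inv_mul _ (isUnit_gram_one (hX i)),
        Matrix.mul_nonsing_inv _ (isUnit_gram_one (hZ i))] at h6
      simpa using h6
    exact (sub_eq_zero.1 (hΔ ▸ h4)).symm
  · rintro rfl Θ' -
    have hs := hsplit (thetaHat X Z Y - Θ')
    rw [sub_sub_cancel] at hs
    have := (hpsd (meanStructure X Z (thetaHat X Z Y - Θ'))).trace_nonneg
    show glsCriterion X Z S Y _ ≤ glsCriterion X Z S Y Θ'
    linarith

end GrowthCurve

/-! Write `E` for the errors and `K(S) = S⁻¹ Z_i (Z_i' S⁻¹ Z_i)⁻¹` (`glsFactor`). Orthogonality of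
the designs gives `X_i' Y = X_i' X_i Θ_i Z_i' + X_i' E`, and `Z_i' K(S) = 1` whenever the inner Gram
matrix is invertible. Hence, with probability tending to `1`, the normalized error is exactly `(n⁻¹
X_i' X_i)⁻¹ (n^{-1/2} X_i' E) K(Σ̂)` (`sqrt_smul_thetaHat_sub`).

The first factor is deterministic and tends to `R_i⁻¹`. The last tends to `K(Σ)` in probability,
because `Σ̂` is consistent: it is a function of the errors alone, equal to `n⁻¹ E'E` up to a scalar
tending to `1` and corrections quadratic in `n⁻¹ X_l' E`, which vanish by Chebyshev's inequality
(`tendsto_inProb_sigmaHat`). The middle factor is asymptotically `N(0, R_i ⊗ Σ)`. Slutsky's theorem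
(`tendstoInDistribution_rowVec_mul_mul`) gives the covariance `R_i⁻¹ R_i R_i⁻¹ ⊗ K(Σ)' Σ K(Σ)`,
which collapses to the one claimed (`glsFactor_covariance`).

The central limit theorem for the middle factor (`tendstoInDistribution_weighted_sum`) concerns
non-identically weighted summands with second moments only. Each one-term characteristic function
differs from its Gaussian counterpart by `o(‖u‖²)`; the vectors `u` are uniformly small and their
squared norms have bounded sum, so the products have the same limit. Uniform smallness comes from
convergence of `n⁻¹ X_i' X_i` alone. -/

namespace GrowthCurve

/-! ### Convergence in probability as convergence along a filter -/

/-- The filter of sets of pairs `(n, ω)` that contain a random point with probability tending to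
`1` as `n → ∞`: convergence along this filter is convergence in probability to a constant. -/
def inProb {Ω : Type*} [MeasurableSpace Ω] (P : Measure Ω) : Filter (ℕ × Ω) where
  sets := {s | Tendsto (fun n => P {ω | (n, ω) ∉ s}) atTop (𝓝 0)}
  univ_sets := by simp
  sets_of_superset := by
    intro s t hs hst
    exact tendsto_of_tendsto_of_tendsto_of_le_of_le tendsto_const_nhds hs (fun _ => zero_le)
      fun n => measure_mono fun ω hω h => hω (hst h)
  inter_sets := by
    intro s t hs ht
    have h := Tendsto.add hs ht
    rw [add_zero] at h
    refine tendsto_of_tendsto_of_tendsto_of_le_of_le tendsto_const_nhds h (fun _ => zero_le)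
      fun n => (measure_mono fun ω hω => ?_).trans (measure_union_le _ _)
    simp only [Set.mem_inter_iff, not_and_or, Set.mem_ofPred_eq] at hω
    exact hω

section InProb

variable {Ω : Type*} [MeasurableSpace Ω] {P : Measure Ω}

lemma mem_inProb {s : Set (ℕ × Ω)} :
    s ∈ inProb P ↔ Tendsto (fun n => P {ω | (n, ω) ∉ s}) atTop (𝓝 0) := Iff.rfl

lemma tendsto_fst_inProb : Tendsto Prod.fst (inProb P) atTop := by
  intro s hs
  rw [mem_map, mem_inProb]
  refine Tendsto.congr' ?_ tendsto_const_nhds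
  filter_upwards [hs] with n hn
  simp [hn]

/-- Lets limits in probability to constants be combined by the ordinary calculus of `Tendsto`, and
translated to `TendstoInMeasure` only where Slutsky's theorem needs it. -/
lemma tendsto_inProb_iff_tendstoInMeasure {E : Type*} [PseudoEMetricSpace E] {f : ℕ → Ω → E}
    {c : E} :
    Tendsto (fun x : ℕ × Ω => f x.1 x.2) (inProb P) (𝓝 c) ↔
      TendstoInMeasure P f atTop fun _ => c := by
  rw [Metric.nhds_basis_eball.tendsto_right_iff]
  refine forall₂_congr fun δ _ => ?_
  simp [Filter.Eventually, mem_inProb, Metric.mem_eball]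

/-- Weighted sums of centred independent identically distributed random variables converge to `0`
in probability as soon as the sum of the squared weights tends to `0`. -/
lemma tendsto_inProb_sum_weights [IsProbabilityMeasure P] {ξ : ℕ → Ω → ℝ} (hindep : iIndepFun ξ P)
    (hident : ∀ j, IdentDistrib (ξ j) (ξ 0) P P) (hL2 : MemLp (ξ 0) 2 P)
    (hmean : ∫ ω, ξ 0 ω ∂P = 0) {c : ℕ → ℕ → ℝ}
    (hc : Tendsto (fun n => ∑ j ∈ Finset.range n, c n j ^ 2) atTop (𝓝 0)) :
    Tendsto (fun x : ℕ × Ω => ∑ j ∈ Finset.range x.1, c x.1 j * ξ j x.2) (inProb P) (𝓝 0) := by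
  have hL (j) : MemLp (ξ j) 2 P := (hident j).memLp_iff.2 hL2
  have hm (j) : ∫ ω, ξ j ω ∂P = 0 := (hident j).integral_eq.trans hmean
  have hLc (n j) : MemLp (fun ω => c n j * ξ j ω) 2 P := (hL j).const_mul _
  have hLs (n) : MemLp (fun ω => ∑ j ∈ Finset.range n, c n j * ξ j ω) 2 P :=
    memLp_finsetSum _ fun j _ => hLc n j
  have hE (n) : ∫ ω, ∑ j ∈ Finset.range n, c n j * ξ j ω ∂P = 0 := by
    rw [integral_finsetSum _ fun j _ => (hLc n j).integrable one_le_two]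
    simp [integral_const_mul, hm]
  have hV (n) : Var[fun ω => ∑ j ∈ Finset.range n, c n j * ξ j ω; P] =
      (∑ j ∈ Finset.range n, c n j ^ 2) * Var[ξ 0; P] := by
    have h := IndepFun.variance_sum (μ := P) (X := fun j ω => c n j * ξ j ω)
      (s := Finset.range n) (fun j _ => hLc n j) (fun i _ j _ hij =>
        (hindep.indepFun hij).comp (φ := fun x => c n i * x) (ψ := fun x => c n j * x)
          (by fun_prop) (by fun_prop))
    rw [Finset.sum_mul]
    convert! h using 2
    · ext ω; simp
    · next j _ => rw [variance_const_mul, (hident j).variance_eq]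
  rw [tendsto_inProb_iff_tendstoInMeasure
    (f := fun n ω => ∑ j ∈ Finset.range n, c n j * ξ j ω), tendstoInMeasure_iff_norm]
  intro δ hδ
  have hlim : Tendsto (fun n => ENNReal.ofReal
      ((∑ j ∈ Finset.range n, c n j ^ 2) * Var[ξ 0; P] / δ ^ 2)) atTop (𝓝 0) := by
    have := ENNReal.tendsto_ofReal ((hc.mul_const Var[ξ 0; P]).div_const (δ ^ 2))
    simpa using this
  refine tendsto_of_tendsto_of_tendsto_of_le_of_le tendsto_const_nhds hlim (fun _ => zero_le)
    fun n => ?_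
  -- Chebyshev's inequality, with the variance computed from pairwise independence.
  have h := meas_ge_le_variance_div_sq (hLs n) hδ
  rw [hE, hV] at h
  simpa using h

/-- The weak law of large numbers, along the filter of convergence in probability. -/
lemma tendsto_inProb_average [IsProbabilityMeasure P] {ξ : ℕ → Ω → ℝ} (hindep : iIndepFun ξ P)
    (hident : ∀ j, IdentDistrib (ξ j) (ξ 0) P P) (hint : Integrable (ξ 0) P) :
    Tendsto (fun x : ℕ × Ω => (x.1 : ℝ)⁻¹ * ∑ j ∈ Finset.range x.1, ξ j x.2) (inProb P)
      (𝓝 (∫ ω, ξ 0 ω ∂P)) := by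
  rw [tendsto_inProb_iff_tendstoInMeasure
    (f := fun n ω => (n : ℝ)⁻¹ * ∑ j ∈ Finset.range n, ξ j ω)]
  refine tendstoInMeasure_of_tendsto_ae (fun n => ?_)
    (strong_law_ae ξ hint (fun i j hij => hindep.indepFun hij) hident)
  exact (Finset.aemeasurable_fun_sum _
    fun j _ => (hident j).aemeasurable_fst).const_mul _ |>.aestronglyMeasurable

end InProb

/-! ### Second-order expansion of characteristic functions -/

open Complex in
/-- The second-order Taylor remainder of `x ↦ exp (i x)` at `0`. -/
noncomputable def expRemainder (x : ℝ) : ℂ := exp (x * I) - 1 - x * I + (x : ℂ) ^ 2 / 2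

open Complex in
-- A bound valid for all `x`, so that second moments suffice for domination. For `|x| ≤ 1` it is
-- Taylor's estimate; for `|x| ≥ 1` each term is itself at most a multiple of `x ^ 2`. The constant
-- is crude.
lemma norm_expRemainder_le (x : ℝ) : ‖expRemainder x‖ ≤ 4 * x ^ 2 := by
  have h2 : ‖(x : ℂ) ^ 2 / 2‖ = x ^ 2 / 2 := by simp
  have h1 : ‖exp (x * I) - 1 - x * I‖ ≤ 3 * x ^ 2 := by
    rcases le_total |x| 1 with h | h
    · have := norm_exp_sub_one_sub_id_le (x := x * I) (by simpa using h)
      have h3 : ‖(x : ℂ) * I‖ ^ 2 = x ^ 2 := by simp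
      nlinarith [sq_nonneg x]
    · have h3 : ‖(x : ℂ) * I‖ = |x| := by simp
      have h4 : ‖exp (x * I)‖ = 1 := norm_exp_ofReal_mul_I x
      have h5 : ‖exp (x * I) - 1 - x * I‖ ≤ 1 + 1 + |x| :=
        (norm_sub_le _ _).trans (add_le_add ((norm_sub_le _ _).trans (by simp [h4])) h3.le)
      nlinarith [sq_abs x]
  refine (norm_add_le _ _).trans ?_
  rw [h2]
  nlinarith [sq_nonneg x]

open Complex Asymptotics in
lemma expRemainder_isLittleO : expRemainder =o[𝓝 0] fun x : ℝ => x ^ 2 := by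
  have h : expRemainder =O[𝓝 0] fun x : ℝ => x ^ 3 := by
    refine IsBigO.of_bound 1 ?_
    filter_upwards [Metric.closedBall_mem_nhds (0 : ℝ) one_pos] with x hx
    have hx' : ‖(x : ℂ) * I‖ ≤ 1 := by simpa using hx
    have := Complex.exp_bound hx' (n := 3) (by norm_num)
    have e : exp (x * I) - ∑ m ∈ Finset.range 3, (x * I) ^ m / (m.factorial : ℂ) =
        expRemainder x := by
      simp only [expRemainder, Finset.sum_range_succ, Finset.sum_range_zero, Nat.factorial,
        mul_pow, I_sq]
      push_cast
      ring
    rw [e] at this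
    refine this.trans ?_
    have h3 : ‖(x : ℂ) * I‖ = |x| := by simp
    rw [h3, norm_pow, Real.norm_eq_abs, one_mul]
    norm_num [Nat.factorial]
    nlinarith [pow_nonneg (abs_nonneg x) 3]
  refine h.trans_isLittleO ?_
  exact isLittleO_pow_pow (by norm_num)

open Complex Asymptotics in
/-- Second-order expansion of the characteristic function of a centred square-integrable random
vector, compared with the centred Gaussian one. -/
lemma charFun_sub_gaussian_isLittleO {Ω : Type*} [MeasurableSpace Ω] {P : Measure Ω}
    [IsProbabilityMeasure P] {p : ℕ} {ξ : Ω → Fin p → ℝ} {S : Matrix (Fin p) (Fin p) ℝ}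
    (hL2 : ∀ a, MemLp (fun ω => ξ ω a) 2 P) (hmean : ∀ a, ∫ ω, ξ ω a ∂P = 0)
    (hcov : ∀ a b, ∫ ω, ξ ω a * ξ ω b ∂P = S a b) :
    (fun u : Fin p → ℝ => ∫ ω, exp ((u ⬝ᵥ ξ ω : ℝ) * I) ∂P - exp (-((u ⬝ᵥ S *ᵥ u : ℝ) : ℂ) / 2))
      =o[𝓝 0] fun u => ‖u‖ ^ 2 := by
  have hLu (u : Fin p → ℝ) : MemLp (fun ω => u ⬝ᵥ ξ ω) 2 P :=
    memLp_finsetSum _ fun a _ => (hL2 a).const_mul _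
  have hmeas (u : Fin p → ℝ) : AEMeasurable (fun ω => u ⬝ᵥ ξ ω) P := (hLu u).1.aemeasurable
  have hEu (u : Fin p → ℝ) : ∫ ω, u ⬝ᵥ ξ ω ∂P = 0 := by
    simp only [dotProduct]
    rw [integral_finsetSum _ fun a _ => ((hL2 a).const_mul _).integrable one_le_two]
    simp [integral_const_mul, hmean]
  have hEu2 (u : Fin p → ℝ) : ∫ ω, (u ⬝ᵥ ξ ω) ^ 2 ∂P = u ⬝ᵥ S *ᵥ u := by
    have hi (a b) : Integrable (fun ω => u a * u b * (ξ ω a * ξ ω b)) P :=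
      ((hL2 a).integrable_mul (hL2 b)).const_mul _
    have e (ω) : (u ⬝ᵥ ξ ω) ^ 2 = ∑ a, ∑ b, u a * u b * (ξ ω a * ξ ω b) := by
      rw [sq, dotProduct, Finset.sum_mul_sum]
      refine Finset.sum_congr rfl fun a _ => Finset.sum_congr rfl fun b _ => by ring
    simp_rw [e]
    rw [integral_finsetSum _ fun a _ => integrable_finsetSum _ fun b _ => hi a b]
    simp_rw [integral_finsetSum _ fun b _ => hi _ b, integral_const_mul, hcov]
    simp only [dotProduct, mulVec, Finset.mul_sum]
    refine Finset.sum_congr rfl fun a _ => Finset.sum_congr rfl fun b _ => by ring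
  have hbound (u : Fin p → ℝ) (v : Fin p → ℝ) : |u ⬝ᵥ v| ≤ ‖u‖ * ∑ a, |v a| := by
    rw [dotProduct, Finset.mul_sum]
    refine (Finset.abs_sum_le_sum_abs _ _).trans (Finset.sum_le_sum fun a _ => ?_)
    rw [abs_mul]
    exact mul_le_mul_of_nonneg_right (norm_le_pi_norm u a) (abs_nonneg _)
  have hsq (u v : Fin p → ℝ) : (u ⬝ᵥ v) ^ 2 ≤ ‖u‖ ^ 2 * (∑ a, |v a|) ^ 2 := by
    rw [← mul_pow, ← sq_abs]
    exact pow_le_pow_left₀ (abs_nonneg _) (hbound u v) 2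
  -- the Gaussian part
  have hdot (v : Fin p → ℝ) : Tendsto (fun u : Fin p → ℝ => u ⬝ᵥ v) (𝓝 0) (𝓝 0) := by
    have : Continuous fun u : Fin p → ℝ => u ⬝ᵥ v := by unfold dotProduct; fun_prop
    simpa using this.tendsto 0
  have hquad : Continuous fun u : Fin p → ℝ => u ⬝ᵥ S *ᵥ u := by
    unfold dotProduct mulVec dotProduct; fun_prop
  have hquad0 : Tendsto (fun u : Fin p → ℝ => u ⬝ᵥ S *ᵥ u) (𝓝 0) (𝓝 0) := by
    simpa using hquad.tendsto 0
  have hquadO : (fun u : Fin p → ℝ => u ⬝ᵥ S *ᵥ u) =O[𝓝 0] fun u => ‖u‖ ^ 2 := by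
    refine IsBigO.of_bound (∑ a, ∑ b, |S a b|) (Eventually.of_forall fun u => ?_)
    rw [Real.norm_eq_abs, Real.norm_of_nonneg (by positivity)]
    simp only [dotProduct, mulVec, Finset.mul_sum, Finset.sum_mul]
    refine (Finset.abs_sum_le_sum_abs _ _).trans (Finset.sum_le_sum fun a _ =>
      (Finset.abs_sum_le_sum_abs _ _).trans (Finset.sum_le_sum fun b _ => ?_))
    rw [abs_mul, abs_mul]
    have ha := norm_le_pi_norm u a
    have hb := norm_le_pi_norm u b
    rw [Real.norm_eq_abs] at ha hb
    calc |u a| * (|S a b| * |u b|) ≤ ‖u‖ * (|S a b| * ‖u‖) := by gcongr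
      _ = |S a b| * ‖u‖ ^ 2 := by ring
  have hgauss : (fun u : Fin p → ℝ => exp (-((u ⬝ᵥ S *ᵥ u : ℝ) : ℂ) / 2) - 1 -
      (-((u ⬝ᵥ S *ᵥ u : ℝ) : ℂ) / 2)) =o[𝓝 0] fun u => ‖u‖ ^ 2 := by
    have h1 : (fun z : ℂ => exp z - 1 - z) =o[𝓝 0] fun z => z := by
      have := (Complex.hasDerivAt_exp 0).isLittleO
      simpa using this
    have h2 : Tendsto (fun u : Fin p → ℝ => -((u ⬝ᵥ S *ᵥ u : ℝ) : ℂ) / 2) (𝓝 0) (𝓝 0) := by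
      have := ((Complex.continuous_ofReal.tendsto 0).comp hquad0).neg.div_const 2
      simpa [Function.comp_def] using this
    refine (h1.comp_tendsto h2).trans_isBigO ?_
    refine IsBigO.trans (IsBigO.of_bound 1 (Eventually.of_forall fun u => ?_)) hquadO
    simp only [Function.comp, norm_div, norm_neg, Complex.norm_real]
    norm_num
  -- the remainder
  have hrem : (fun u : Fin p → ℝ => ∫ ω, expRemainder (u ⬝ᵥ ξ ω) ∂P) =o[𝓝 0]
      fun u => ‖u‖ ^ 2 := by
    have hcont : Continuous expRemainder := by unfold expRemainder; fun_prop
    -- Dominated convergence: the quotient tends to `0` for each `ω` and is at most `4 * (∑ a, |ξ ω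
    -- a|) ^ 2`, integrable by the second moments. At `u = 0` the quotient is `0 / 0 = 0`.
    have hdom : Tendsto (fun u : Fin p → ℝ => ∫ ω, ‖expRemainder (u ⬝ᵥ ξ ω)‖ / ‖u‖ ^ 2 ∂P) (𝓝 0)
        (𝓝 (∫ _, (0 : ℝ) ∂P)) := by
      refine tendsto_integral_filter_of_dominated_convergence
        (fun ω => 4 * (∑ a, |ξ ω a|) ^ 2) ?_ ?_ ?_ ?_
      · refine Eventually.of_forall fun u => ?_
        exact ((hcont.measurable.comp_aemeasurable (hmeas u)).norm.div_const _).aestronglyMeasurable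
      · refine Eventually.of_forall fun u => ae_of_all _ fun ω => ?_
        rw [Real.norm_of_nonneg (by positivity)]
        refine div_le_of_le_mul₀ (by positivity) (by positivity) ?_
        refine (norm_expRemainder_le _).trans ?_
        nlinarith [hsq u (ξ ω)]
      · have : MemLp (fun ω => ∑ a, |ξ ω a|) 2 P := memLp_finsetSum _ fun a _ => (hL2 a).abs
        exact this.integrable_sq.const_mul 4
      · refine ae_of_all _ fun ω => ?_
        have h1 : (fun u : Fin p → ℝ => ‖expRemainder (u ⬝ᵥ ξ ω)‖) =o[𝓝 0]
            fun u : Fin p → ℝ => ‖u‖ ^ 2 := by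
          refine ((expRemainder_isLittleO.comp_tendsto (hdot (ξ ω))).trans_isBigO ?_).norm_left
          refine IsBigO.of_bound ((∑ a, |ξ ω a|) ^ 2) (Eventually.of_forall fun u => ?_)
          simp only [Function.comp, norm_pow, Real.norm_eq_abs, sq_abs, abs_norm]
          linarith [hsq u (ξ ω)]
        exact h1.tendsto_div_nhds_zero
    rw [integral_zero] at hdom
    have h0 : ∀ u : Fin p → ℝ, ‖u‖ ^ 2 = 0 → ∫ ω, ‖expRemainder (u ⬝ᵥ ξ ω)‖ ∂P = 0 := by
      intro u hu
      have : u = 0 := by simpa using hu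
      simp [this, expRemainder]
    have h1 : (fun u : Fin p → ℝ => ∫ ω, ‖expRemainder (u ⬝ᵥ ξ ω)‖ ∂P) =o[𝓝 0]
        fun u => ‖u‖ ^ 2 := by
      rw [isLittleO_iff_tendsto h0]
      simpa [integral_div] using hdom
    refine IsBigO.trans_isLittleO (IsBigO.of_bound 1 (Eventually.of_forall fun u => ?_)) h1
    rw [one_mul]
    exact (norm_integral_le_integral_norm _).trans (le_abs_self _)
  -- The expansions agree to second order: the mean being `0` kills the linear term, and the
  -- quadratic terms coincide by the choice of `S`. Only the two remainders are left.
  refine (hrem.sub hgauss).congr_left fun u => ?_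
  have hi1 : Integrable (fun ω => exp ((u ⬝ᵥ ξ ω : ℝ) * I)) P := by
    refine Integrable.of_bound (C := 1) ?_ (ae_of_all _ fun ω => by
      rw [norm_exp_ofReal_mul_I])
    have hc : Continuous fun x : ℝ => exp (x * I) := by fun_prop
    exact (hc.measurable.comp_aemeasurable (hmeas u)).aestronglyMeasurable
  have hi2 : Integrable (fun ω => ((u ⬝ᵥ ξ ω : ℝ) : ℂ) * I) P :=
    (((hLu u).integrable one_le_two).ofReal).mul_const _
  have hi3 : Integrable (fun ω => ((u ⬝ᵥ ξ ω : ℝ) : ℂ) ^ 2 / 2) P := by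
    have := ((hLu u).integrable_sq.ofReal (𝕜 := ℂ)).div_const 2
    simpa using this
  have e2 : ∫ ω, ((u ⬝ᵥ ξ ω : ℝ) : ℂ) * I ∂P = 0 := by
    rw [integral_mul_const, integral_complex_ofReal, hEu]; simp
  have e3 : ∫ ω, ((u ⬝ᵥ ξ ω : ℝ) : ℂ) ^ 2 / 2 ∂P = ((u ⬝ᵥ S *ᵥ u : ℝ) : ℂ) / 2 := by
    rw [integral_div, ← hEu2, ← integral_complex_ofReal]; simp
  have hi4 : Integrable (fun ω => exp ((u ⬝ᵥ ξ ω : ℝ) * I) - 1) P := hi1.sub (integrable_const _)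
  have hi5 : Integrable (fun ω => exp ((u ⬝ᵥ ξ ω : ℝ) * I) - 1 - (u ⬝ᵥ ξ ω : ℝ) * I) P :=
    hi4.sub hi2
  simp only [expRemainder]
  rw [integral_add hi5 hi3, integral_sub hi4 hi2, integral_sub hi1 (integrable_const _), e2, e3]
  simp
  ring

/-- Replace the factors one at a time; since all factors lie in the unit disc, the others do not
amplify the error of a replacement. -/
lemma norm_prod_sub_prod_le {ι : Type*} (s : Finset ι) (z w : ι → ℂ) (hz : ∀ i ∈ s, ‖z i‖ ≤ 1)
    (hw : ∀ i ∈ s, ‖w i‖ ≤ 1) : ‖∏ i ∈ s, z i - ∏ i ∈ s, w i‖ ≤ ∑ i ∈ s, ‖z i - w i‖ := by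
  classical
  induction s using Finset.induction_on with
  | empty => simp
  | insert a s ha ih =>
    rw [Finset.prod_insert ha, Finset.prod_insert ha, Finset.sum_insert ha]
    have hz' : ‖∏ i ∈ s, z i‖ ≤ 1 := by
      rw [norm_prod]
      exact Finset.prod_le_one (fun _ _ => norm_nonneg _)
        fun i hi => hz i (Finset.mem_insert_of_mem hi)
    have e : z a * ∏ i ∈ s, z i - w a * ∏ i ∈ s, w i =
        (z a - w a) * ∏ i ∈ s, z i + w a * (∏ i ∈ s, z i - ∏ i ∈ s, w i) := by ring
    rw [e]
    refine (norm_add_le _ _).trans (add_le_add ?_ ?_)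
    · rw [norm_mul]
      exact mul_le_of_le_one_right (norm_nonneg _) hz'
    · rw [norm_mul]
      exact (mul_le_of_le_one_left (norm_nonneg _) (hw a (Finset.mem_insert_self _ _))).trans
        (ih (fun i hi => hz i (Finset.mem_insert_of_mem hi))
          fun i hi => hw i (Finset.mem_insert_of_mem hi))

/-! ### Central limit theorem for weighted sums -/

/-- The coefficient vector `T' c`, through which `⟨T, c v'⟩` depends on `v`. -/
def coeffVec {m p : ℕ} (T : EuclideanSpace ℝ (Fin m × Fin p)) (c : Fin m → ℝ) : Fin p → ℝ :=
  fun b => ∑ a, T (a, b) * c a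

lemma inner_rowVec_vecMulVec {m p : ℕ} (T : EuclideanSpace ℝ (Fin m × Fin p)) (c : Fin m → ℝ)
    (v : Fin p → ℝ) : inner ℝ (rowVec (vecMulVec c v)) T = coeffVec T c ⬝ᵥ v := by
  simp only [PiLp.inner_apply, rowVec, vecMulVec_apply, coeffVec, dotProduct, Fintype.sum_prod_type,
    Finset.sum_mul]
  rw [Finset.sum_comm]
  refine Finset.sum_congr rfl fun b _ => Finset.sum_congr rfl fun a _ => ?_
  simp only [RCLike.inner_apply, conj_trivial]
  ring

/-- With `S` the error covariance, the left side is the variance of the weighted sum in the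
direction `T`. It depends on the weights only through their Gram matrix, whose limit is assumed. -/
lemma sum_coeffVec_quadratic {ι : Type*} {m p : ℕ} (T : EuclideanSpace ℝ (Fin m × Fin p))
    (s : Finset ι) (c : ι → Fin m → ℝ) (S : Matrix (Fin p) (Fin p) ℝ) :
    ∑ j ∈ s, coeffVec T (c j) ⬝ᵥ S *ᵥ coeffVec T (c j) =
      T ⬝ᵥ ((Matrix.of fun a a' => ∑ j ∈ s, c j a * c j a') ⊗ₖ S) *ᵥ T := by
  have h (j) : coeffVec T (c j) ⬝ᵥ S *ᵥ coeffVec T (c j) =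
      ∑ a, ∑ b, ∑ a', ∑ b', T (a, b) * (c j a * c j a' * S b b' * T (a', b')) := by
    simp only [dotProduct, mulVec, coeffVec, Finset.sum_mul, Finset.mul_sum]
    conv_rhs => rw [Finset.sum_comm]
    refine Finset.sum_congr rfl fun b _ => ?_
    conv_lhs => enter [2, b']; rw [Finset.sum_comm]
    rw [Finset.sum_comm]
    refine Finset.sum_congr rfl fun a _ => ?_
    rw [Finset.sum_comm]
    refine Finset.sum_congr rfl fun a' _ => Finset.sum_congr rfl fun b' _ => ?_
    ring
  simp_rw [h]
  simp only [dotProduct, mulVec, Fintype.sum_prod_type, kroneckerMap_apply, of_apply,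
    Finset.sum_mul, Finset.mul_sum]
  rw [Finset.sum_comm]
  refine Finset.sum_congr rfl fun a _ => ?_
  rw [Finset.sum_comm]
  refine Finset.sum_congr rfl fun b _ => ?_
  rw [Finset.sum_comm]
  refine Finset.sum_congr rfl fun a' _ => ?_
  rw [Finset.sum_comm]

lemma norm_coeffVec_le {m p : ℕ} (T : EuclideanSpace ℝ (Fin m × Fin p)) (c : Fin m → ℝ) :
    ‖coeffVec T c‖ ≤ (∑ a, ∑ b, |T (a, b)|) * ‖c‖ := by
  rw [pi_norm_le_iff_of_nonneg (by positivity)]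
  intro b
  rw [Real.norm_eq_abs, coeffVec, Finset.sum_mul]
  refine (Finset.abs_sum_le_sum_abs _ _).trans (Finset.sum_le_sum fun a _ => ?_)
  rw [abs_mul]
  gcongr
  · exact Finset.single_le_sum (f := fun b => |T (a, b)|) (s := Finset.univ)
      (fun _ _ => abs_nonneg _)
      (Finset.mem_univ b)
  · exact norm_le_pi_norm c a

/-- The norm is the supremum norm. The identity matrix is kept on the right so that
`sum_coeffVec_quadratic` also controls the sum of squared norms. -/
lemma norm_sq_le_dotProduct {p : ℕ} (u : Fin p → ℝ) : ‖u‖ ^ 2 ≤ u ⬝ᵥ (1 : Matrix _ _ ℝ) *ᵥ u := by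
  rw [one_mulVec]
  have h0 : 0 ≤ u ⬝ᵥ u := Finset.sum_nonneg fun b _ => mul_self_nonneg _
  have : ‖u‖ ≤ √(u ⬝ᵥ u) := by
    rw [pi_norm_le_iff_of_nonneg (Real.sqrt_nonneg _)]
    intro b
    refine Real.abs_le_sqrt ?_
    rw [sq]
    exact Finset.single_le_sum (f := fun b => u b * u b) (fun _ _ => mul_self_nonneg _)
      (Finset.mem_univ b)
  calc ‖u‖ ^ 2 ≤ √(u ⬝ᵥ u) ^ 2 := by gcongr
    _ = _ := Real.sq_sqrt h0

lemma measurable_rowVec_vecMulVec {m p : ℕ} (c : Fin m → ℝ) :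
    Measurable fun v : Fin p → ℝ => rowVec (vecMulVec c v) := by
  refine (WithLp.measurable_toLp 2 _).comp (measurable_pi_iff.2 fun ab => ?_)
  simp only [vecMulVec_apply]
  fun_prop

open Complex in
/-- The central limit theorem for weighted sums `∑ j < n, c_{n,j} ε_j'` of independent identically
distributed centred random vectors, with weights that are uniformly negligible. -/
theorem tendstoInDistribution_weighted_sum {Ω : Type*} [MeasurableSpace Ω] {P : Measure Ω}
    [IsProbabilityMeasure P] {m p : ℕ} {ε : ℕ → Ω → Fin p → ℝ} {S : Matrix (Fin p) (Fin p) ℝ}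
    (hindep : iIndepFun ε P) (hident : ∀ j, IdentDistrib (ε j) (ε 0) P P)
    (hL2 : ∀ a, MemLp (fun ω => ε 0 ω a) 2 P) (hmean : ∀ a, ∫ ω, ε 0 ω a ∂P = 0)
    (hcov : ∀ a b, ∫ ω, ε 0 ω a * ε 0 ω b ∂P = S a b) (hS : S.PosSemidef)
    {c : ℕ → ℕ → Fin m → ℝ} {Q : Matrix (Fin m) (Fin m) ℝ} (hQ : Q.PosSemidef)
    (hc : Tendsto (fun n => Matrix.of fun a a' => ∑ j ∈ Finset.range n, c n j a * c n j a') atTop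
      (𝓝 Q))
    (hc0 : ∀ δ > 0, ∀ᶠ n in atTop, ∀ j < n, ‖c n j‖ < δ) :
    TendstoInDistribution
      (fun n ω => ∑ j ∈ Finset.range n, rowVec (vecMulVec (c n j) (ε j ω))) atTop id (fun _ => P)
      (matrixNormal Q S) := by
  have hmeas (n j) : AEMeasurable (fun ω => rowVec (vecMulVec (c n j) (ε j ω))) P :=
    (measurable_rowVec_vecMulVec _).comp_aemeasurable (hident j).aemeasurable_fst
  refine ⟨fun n => Finset.aemeasurable_fun_sum _ fun j _ => hmeas n j, aemeasurable_id, ?_⟩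
  refine ProbabilityMeasure.tendsto_iff_tendsto_charFun.2 fun T => ?_
  set u : ℕ → ℕ → Fin p → ℝ := fun n j => coeffVec T (c n j) with hu
  set ψ : (Fin p → ℝ) → ℂ := fun u => ∫ ω, exp ((u ⬝ᵥ ε 0 ω : ℝ) * I) ∂P with hψ
  set γ : (Fin p → ℝ) → ℂ := fun u => exp (-((u ⬝ᵥ S *ᵥ u : ℝ) : ℂ) / 2) with hγ
  have hchar (n : ℕ) : charFun (P.map fun ω =>
      ∑ j ∈ Finset.range n, rowVec (vecMulVec (c n j) (ε j ω))) T =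
      ∏ j ∈ Finset.range n, ψ (u n j) := by
    have hind : iIndepFun (fun j ω => rowVec (vecMulVec (c n j) (ε j ω))) P :=
      hindep.comp (fun j v => rowVec (vecMulVec (c n j) v)) fun j => measurable_rowVec_vecMulVec _
    rw [iIndepFun.charFun_map_fun_finsetSum_eq_prod (fun j _ => hmeas n j) (hind.restrict _),
      Finset.prod_apply]
    refine Finset.prod_congr rfl fun j _ => ?_
    have hid : IdentDistrib (fun ω => rowVec (vecMulVec (c n j) (ε j ω)))
        (fun ω => rowVec (vecMulVec (c n j) (ε 0 ω))) P P :=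
      (hident j).comp (u := fun v => rowVec (vecMulVec (c n j) v)) (measurable_rowVec_vecMulVec _)
    rw [hid.map_eq, charFun_apply, integral_map hid.aemeasurable_snd]
    · simp only [inner_rowVec_vecMulVec, hψ, hu]
    · exact Measurable.aestronglyMeasurable (by fun_prop)
  -- Used for `M = S`, to find the limiting variance, and for `M = 1`, to bound the sum of the
  -- squared norms of `u n j`.
  have hlim (M : Matrix (Fin p) (Fin p) ℝ) :
      Tendsto (fun n => ∑ j ∈ Finset.range n, u n j ⬝ᵥ M *ᵥ u n j) atTop
        (𝓝 (T ⬝ᵥ (Q ⊗ₖ M) *ᵥ T)) := by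
    simp only [hu, sum_coeffVec_quadratic]
    have : Continuous fun A : Matrix (Fin m) (Fin m) ℝ => T ⬝ᵥ (A ⊗ₖ M) *ᵥ T := by
      simp only [dotProduct, mulVec, kroneckerMap_apply]
      fun_prop
    exact (this.tendsto Q).comp hc
  have hgauss : Tendsto (fun n => ∏ j ∈ Finset.range n, γ (u n j)) atTop
      (𝓝 (charFun (matrixNormal Q S) T)) := by
    rw [matrixNormal, charFun_multivariateGaussian (hQ.kronecker hS)]
    have h := ((continuous_exp.comp (continuous_ofReal.neg.div_const 2)).tendsto _).comp (hlim S)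
    refine (h.congr fun n => ?_).trans_eq ?_
    · simp only [Function.comp, hγ, ← exp_sum]
      congr 1
      rw [← Finset.sum_div, Finset.sum_neg_distrib, Pi.neg_apply, ofReal_sum]
    · simp [neg_div]
  have hψ1 (u) : ‖ψ u‖ ≤ 1 := by
    refine (norm_integral_le_integral_norm _).trans ?_
    simp only [norm_exp_ofReal_mul_I]
    simp
  have hγ1 (u) : ‖γ u‖ ≤ 1 := by
    have : 0 ≤ u ⬝ᵥ S *ᵥ u := by simpa using hS.dotProduct_mulVec_nonneg u
    rw [hγ, norm_exp]
    refine Real.exp_le_one_iff.2 ?_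
    have e : (-((u ⬝ᵥ S *ᵥ u : ℝ) : ℂ) / 2).re = -(u ⬝ᵥ S *ᵥ u) / 2 := by
      rw [← ofReal_neg, ← ofReal_ofNat, ← ofReal_div, ofReal_re]
    rw [e]
    linarith
  have hdiff : Tendsto (fun n => ∏ j ∈ Finset.range n, ψ (u n j) -
      ∏ j ∈ Finset.range n, γ (u n j)) atTop (𝓝 0) := by
    rw [Metric.tendsto_nhds]
    intro η hη
    set C := T ⬝ᵥ (Q ⊗ₖ (1 : Matrix (Fin p) (Fin p) ℝ)) *ᵥ T + 1 with hC
    have hC1 : ∀ᶠ n in atTop,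
        ∑ j ∈ Finset.range n, u n j ⬝ᵥ (1 : Matrix (Fin p) (Fin p) ℝ) *ᵥ u n j < C :=
      (hlim 1).eventually_lt_const (by simp [hC])
    have hCpos : 0 < C := by
      obtain ⟨n, hn⟩ := hC1.exists
      exact lt_of_le_of_lt (Finset.sum_nonneg fun j _ =>
        (sq_nonneg _).trans (norm_sq_le_dotProduct _)) hn
    -- Tolerance per unit of squared norm: the squared norms sum to less than `C`, so the total
    -- error is at most `η / 2`.
    have hη' : 0 < η / (2 * C) := by positivity
    obtain ⟨δ, hδ, hδ'⟩ := Metric.eventually_nhds_iff.1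
      ((charFun_sub_gaussian_isLittleO hL2 hmean hcov).def hη')
    set K := ∑ a, ∑ b, |T (a, b)| with hK
    have hK0 : 0 ≤ K := by positivity
    -- Weights this small force `‖u n j‖ < δ`; the `+ 1` covers `K = 0`, which occurs for `T = 0`.
    filter_upwards [hC1, hc0 (δ / (K + 1)) (by positivity)] with n hn1 hn2
    rw [dist_zero_right]
    refine (norm_prod_sub_prod_le _ _ _ (fun _ _ => hψ1 _) fun _ _ => hγ1 _).trans_lt ?_
    have hj : ∀ j ∈ Finset.range n, ‖ψ (u n j) - γ (u n j)‖ ≤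
        η / (2 * C) * (u n j ⬝ᵥ (1 : Matrix (Fin p) (Fin p) ℝ) *ᵥ u n j) := by
      intro j hj
      have h1 : ‖u n j‖ < δ := by
        refine (norm_coeffVec_le T _).trans_lt ?_
        have h2 := hn2 j (Finset.mem_range.1 hj)
        rw [lt_div_iff₀ (by positivity)] at h2
        nlinarith [norm_nonneg (c n j)]
      have h3 := hδ' (y := u n j) (by rwa [dist_zero_right])
      refine h3.trans ?_
      rw [norm_pow, norm_norm]
      exact mul_le_mul_of_nonneg_left (norm_sq_le_dotProduct _) hη'.le
    refine (Finset.sum_le_sum hj).trans_lt ?_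
    rw [← Finset.mul_sum]
    calc _ ≤ η / (2 * C) * C := by gcongr
      _ = η / 2 := by field_simp
      _ < η := by linarith
  have := hdiff.add hgauss
  simp only [sub_add_cancel, zero_add] at this
  simpa [hchar] using this

/-! ### Algebra of the two estimators -/

section LinearAlgebra

variable {n p k : ℕ}

/-- The projection of `v` is the point of the column space whose residual is orthogonal to it; `Xᵀ`
annihilates the residual by cancelling the Gram matrix. -/
lemma projCol_eq {d : ℕ} {X : Matrix (Fin n) (Fin d) ℝ} (h : IsUnit (Xᵀ * X).det) :
    projCol X = X * (Xᵀ * X)⁻¹ * Xᵀ := by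
  rw [projCol, LinearEquiv.symm_apply_eq]
  ext1 v
  refine Submodule.eq_starProjection_of_mem_orthogonal (K := LinearMap.range (toEuclideanLin X))
    (v := toEuclideanLin (X * (Xᵀ * X)⁻¹ * Xᵀ) v) ?_ ?_
  · exact ⟨WithLp.toLp 2 (((Xᵀ * X)⁻¹ * Xᵀ) *ᵥ v), by
      simp [Matrix.toLpLin_apply, Matrix.mul_assoc]⟩
  · rw [Submodule.mem_orthogonal]
    rintro _ ⟨w, rfl⟩
    have e : Xᵀ *ᵥ (v.ofLp - (X * (Xᵀ * X)⁻¹ * Xᵀ) *ᵥ v.ofLp) = 0 := by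
      rw [mulVec_sub, mulVec_mulVec, ← Matrix.mul_assoc, ← Matrix.mul_assoc,
        Matrix.mul_nonsing_inv _ h, Matrix.one_mul, sub_self]
    rw [EuclideanSpace.inner_eq_star_dotProduct]
    simp only [Matrix.toLpLin_apply, star_trivial, WithLp.ofLp_sub]
    rw [dotProduct_mulVec, ← mulVec_transpose, e, zero_dotProduct]

variable {m q : Fin k → ℕ} {X : ∀ i, Matrix (Fin n) (Fin (m i)) ℝ}

lemma one_sub_sum_projCol_mul (hX : ∀ i j, i ≠ j → (X i)ᵀ * X j = 0)
    (hu : ∀ i, IsUnit ((X i)ᵀ * X i).det) (i : Fin k) : (1 - ∑ j, projCol (X j)) * X i = 0 := by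
  rw [Matrix.sub_mul, Matrix.one_mul, Matrix.sum_mul, Finset.sum_eq_single i]
  · rw [projCol_eq (hu i), Matrix.mul_assoc, Matrix.mul_assoc, Matrix.nonsing_inv_mul _ (hu i),
      Matrix.mul_one, sub_self]
  · intro j _ hj
    rw [projCol_eq (hu j), Matrix.mul_assoc, hX j i hj, Matrix.mul_zero]
  · simp

lemma transpose_projCol {d : ℕ} {X : Matrix (Fin n) (Fin d) ℝ} (h : IsUnit (Xᵀ * X).det) :
    (projCol X)ᵀ = projCol X := by
  rw [projCol_eq h]
  simp [transpose_nonsing_inv, Matrix.mul_assoc]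

/-- The covariance estimator depends on the errors only. -/
lemma sigmaHat_meanStructure_add (hX : ∀ i j, i ≠ j → (X i)ᵀ * X j = 0)
    (hu : ∀ i, IsUnit ((X i)ᵀ * X i).det) (Z : ∀ i, Matrix (Fin p) (Fin (q i)) ℝ)
    (Θ : ∀ i, Matrix (Fin (m i)) (Fin (q i)) ℝ) (E : Matrix (Fin n) (Fin p) ℝ) :
    sigmaHat X (meanStructure X Z Θ + E) = sigmaHat X E := by
  set B := 1 - ∑ j, projCol (X j) with hB
  have h1 : B * meanStructure X Z Θ = 0 := by
    rw [meanStructure, Matrix.mul_sum]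
    refine Finset.sum_eq_zero fun i _ => ?_
    rw [Matrix.mul_assoc, ← Matrix.mul_assoc, one_sub_sum_projCol_mul hX hu, Matrix.zero_mul]
  have hBt : Bᵀ = B := by
    simp [hB, transpose_sum, transpose_projCol (hu _)]
  have h2 : (meanStructure X Z Θ)ᵀ * B = 0 := by
    rw [← hBt, ← transpose_mul, h1, transpose_zero]
  simp only [sigmaHat, ← hB, transpose_add, Matrix.mul_smul, Matrix.smul_mul, Matrix.add_mul,
    Matrix.mul_add, h2, zero_add]
  rw [Matrix.mul_assoc, h1, Matrix.mul_zero, smul_zero, zero_add]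

/-- The covariance estimator in terms of normalized cross products. -/
lemma sigmaHat_eq (hn : n ≠ 0) (hu : ∀ i, IsUnit ((X i)ᵀ * X i).det)
    (E : Matrix (Fin n) (Fin p) ℝ) :
    sigmaHat X E = (((n : ℝ) - ∑ i, ((X i).rank : ℝ))⁻¹ * n) • ((n : ℝ)⁻¹ • (Eᵀ * E) -
      ∑ i, ((n : ℝ)⁻¹ • ((X i)ᵀ * E))ᵀ * ((n : ℝ)⁻¹ • ((X i)ᵀ * X i))⁻¹ *
        ((n : ℝ)⁻¹ • ((X i)ᵀ * E))) := by
  have hn' : (n : ℝ) ≠ 0 := Nat.cast_ne_zero.2 hn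
  have h (i) : ((n : ℝ)⁻¹ • ((X i)ᵀ * E))ᵀ * ((n : ℝ)⁻¹ • ((X i)ᵀ * X i))⁻¹ *
      ((n : ℝ)⁻¹ • ((X i)ᵀ * E)) = (n : ℝ)⁻¹ • (Eᵀ * projCol (X i) * E) := by
    have hi : ((n : ℝ)⁻¹ • ((X i)ᵀ * X i))⁻¹ = (n : ℝ) • ((X i)ᵀ * X i)⁻¹ := by
      have := Matrix.inv_smul' ((X i)ᵀ * X i) (Units.mk0 (n : ℝ)⁻¹ (inv_ne_zero hn')) (hu i)
      simpa [Units.smul_def] using this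
    rw [hi, projCol_eq (hu i)]
    simp only [transpose_smul, transpose_mul, transpose_transpose, Matrix.smul_mul,
      Matrix.mul_smul, smul_smul, Matrix.mul_assoc]
    rw [mul_inv_cancel₀ hn', mul_one]
  simp only [h, ← Finset.smul_sum, ← smul_sub, smul_smul]
  rw [mul_assoc, mul_inv_cancel₀ hn', mul_one, sigmaHat, Matrix.mul_smul, Matrix.smul_mul,
    Matrix.mul_sub, Matrix.sub_mul, Matrix.mul_one, Matrix.mul_sum, Matrix.sum_mul]

/-- The factor `S⁻¹ Z (Z' S⁻¹ Z)⁻¹` by which the estimator weights the columns of the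
observations. -/
noncomputable def glsFactor {d : ℕ} (S : Matrix (Fin p) (Fin p) ℝ) (Z : Matrix (Fin p) (Fin d) ℝ) :
    Matrix (Fin p) (Fin d) ℝ :=
  S⁻¹ * Z * (Zᵀ * S⁻¹ * Z)⁻¹

/-- The normalized estimation error. -/
lemma sqrt_smul_thetaHat_sub (hn : n ≠ 0) (hX : ∀ i j, i ≠ j → (X i)ᵀ * X j = 0)
    (Z : ∀ i, Matrix (Fin p) (Fin (q i)) ℝ) (Θ : ∀ i, Matrix (Fin (m i)) (Fin (q i)) ℝ)
    (E : Matrix (Fin n) (Fin p) ℝ) (i : Fin k) (hu : IsUnit ((X i)ᵀ * X i).det)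
    (hZ : (Z i).rank = q i)
    (hS : IsUnit ((Z i)ᵀ * (sigmaHat X (meanStructure X Z Θ + E))⁻¹ * Z i).det) :
    √n • (thetaHat X Z (meanStructure X Z Θ + E) i - Θ i) =
      ((n : ℝ)⁻¹ • ((X i)ᵀ * X i))⁻¹ * ((√n)⁻¹ • ((X i)ᵀ * E)) *
        glsFactor (sigmaHat X (meanStructure X Z Θ + E)) (Z i) := by
  have hn' : (n : ℝ) ≠ 0 := Nat.cast_ne_zero.2 hn
  set S := sigmaHat X (meanStructure X Z Θ + E)
  set G := (X i)ᵀ * X i with hG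
  have hi : ((n : ℝ)⁻¹ • G)⁻¹ = (n : ℝ) • G⁻¹ := by
    have := Matrix.inv_smul' G (Units.mk0 (n : ℝ)⁻¹ (inv_ne_zero hn')) hu
    simpa [Units.smul_def] using this
  have hK : weightMatrix S (Z i) * Z i * ((Z i)ᵀ * Z i)⁻¹ = glsFactor S (Z i) := by
    rw [weightMatrix, glsFactor, Matrix.mul_assoc _ (Z i)ᵀ, Matrix.mul_assoc _ ((Z i)ᵀ * Z i),
      Matrix.mul_nonsing_inv _ (isUnit_gram_one hZ), Matrix.mul_one]
  have hM : (X i)ᵀ * meanStructure X Z Θ = G * Θ i * (Z i)ᵀ := by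
    rw [meanStructure, Matrix.mul_sum, Finset.sum_eq_single i]
    · simp only [hG, Matrix.mul_assoc]
    · intro j _ hj
      simp only [← Matrix.mul_assoc]
      rw [hX i j hj.symm]
      simp
    · simp
  -- Because of this identity `Θ i` is reproduced exactly, whatever the estimated covariance, and no
  -- bias term remains.
  have hZK : (Z i)ᵀ * glsFactor S (Z i) = 1 := by
    rw [glsFactor, ← Matrix.mul_assoc, ← Matrix.mul_assoc, Matrix.mul_nonsing_inv _ hS]
  have hθ : thetaHat X Z (meanStructure X Z Θ + E) i =
      Θ i + G⁻¹ * ((X i)ᵀ * E) * glsFactor S (Z i) := by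
    have : thetaHat X Z (meanStructure X Z Θ + E) i = G⁻¹ * ((X i)ᵀ *
        (meanStructure X Z Θ + E)) * (weightMatrix S (Z i) * Z i * ((Z i)ᵀ * Z i)⁻¹) := by
      simp only [thetaHat, Matrix.mul_assoc, S, G]
    rw [this, hK, Matrix.mul_add, hM, Matrix.mul_add, Matrix.add_mul, ← Matrix.mul_assoc,
      ← Matrix.mul_assoc, Matrix.nonsing_inv_mul _ hu, Matrix.one_mul, Matrix.mul_assoc (Θ i),
      hZK, Matrix.mul_one]
  rw [hθ, add_sub_cancel_left, hi]
  simp only [Matrix.smul_mul, Matrix.mul_smul, smul_smul]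
  congr 1
  rw [inv_mul_eq_div, Real.div_sqrt]

end LinearAlgebra

/-! ### Matrix normal laws under linear maps -/

section MatrixNormal

lemma rowVec_dotProduct {a b : ℕ} (M N : Matrix (Fin a) (Fin b) ℝ) :
    (rowVec M).ofLp ⬝ᵥ (rowVec N).ofLp = (Mᵀ * N).trace := by
  simp only [rowVec, dotProduct, Fintype.sum_prod_type, trace, diag_apply, mul_apply,
    transpose_apply]
  rw [Finset.sum_comm]

/-- Stacking rows rather than columns is what puts `A`, acting from the left, in the first Kronecker
factor. -/
lemma kronecker_mulVec_rowVec {a b c d : ℕ} (A : Matrix (Fin c) (Fin a) ℝ)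
    (B : Matrix (Fin d) (Fin b) ℝ) (M : Matrix (Fin a) (Fin b) ℝ) :
    (A ⊗ₖ B) *ᵥ (rowVec M).ofLp = (rowVec (A * M * Bᵀ)).ofLp := by
  ext ⟨i, j⟩
  simp only [rowVec, mulVec, dotProduct, Fintype.sum_prod_type, kroneckerMap_apply, mul_apply,
    transpose_apply, Finset.sum_mul]
  rw [Finset.sum_comm]
  refine Finset.sum_congr rfl fun x _ => Finset.sum_congr rfl fun y _ => by ring

/-- The matrix with given stacked rows. -/
def unrowVec {a b : ℕ} (v : EuclideanSpace ℝ (Fin a × Fin b)) : Matrix (Fin a) (Fin b) ℝ :=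
  Matrix.of fun i j => v (i, j)

@[simp]
lemma rowVec_unrowVec {a b : ℕ} (v : EuclideanSpace ℝ (Fin a × Fin b)) :
    rowVec (unrowVec v) = v := rfl

@[simp]
lemma unrowVec_rowVec {a b : ℕ} (M : Matrix (Fin a) (Fin b) ℝ) : unrowVec (rowVec M) = M := rfl

lemma continuous_rowVec {a b : ℕ} :
    Continuous (rowVec : Matrix (Fin a) (Fin b) ℝ → EuclideanSpace ℝ (Fin a × Fin b)) := by
  unfold rowVec
  fun_prop

lemma continuous_unrowVec {a b : ℕ} :
    Continuous (unrowVec : EuclideanSpace ℝ (Fin a × Fin b) → Matrix (Fin a) (Fin b) ℝ) := by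
  refine continuous_pi fun i => continuous_pi fun j => ?_
  simp only [unrowVec, of_apply]
  fun_prop

/-- Linear images of matrix normal laws. -/
lemma map_matrixNormal {a b c d : ℕ} {Q : Matrix (Fin a) (Fin a) ℝ} {S : Matrix (Fin b) (Fin b) ℝ}
    (hQ : Q.PosSemidef) (hS : S.PosSemidef) (A : Matrix (Fin c) (Fin a) ℝ)
    (K : Matrix (Fin b) (Fin d) ℝ) :
    (matrixNormal Q S).map (fun v => rowVec (A * unrowVec v * K)) =
      matrixNormal (A * Q * Aᵀ) (Kᵀ * S * K) := by
  have hcont : Continuous fun v : EuclideanSpace ℝ (Fin a × Fin b) =>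
      rowVec (A * unrowVec v * K) :=
    continuous_rowVec.comp ((continuous_const.matrix_mul continuous_unrowVec).matrix_mul
      continuous_const)
  have : IsProbabilityMeasure ((matrixNormal Q S).map fun v => rowVec (A * unrowVec v * K)) :=
    Measure.isProbabilityMeasure_map hcont.measurable.aemeasurable
  have hQ' : (A * Q * Aᵀ).PosSemidef := by
    simpa [conjTranspose_eq_transpose_of_trivial] using hQ.mul_mul_conjTranspose_same A
  have hS' : (Kᵀ * S * K).PosSemidef := by
    simpa [conjTranspose_eq_transpose_of_trivial] using hS.conjTranspose_mul_mul_same K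
  refine Measure.ext_of_charFun (funext fun T => ?_)
  -- The adjoint of `M ↦ A M K` for the trace inner product is `M ↦ A' M K'`, by cyclicity of the
  -- trace.
  have hinner (v : EuclideanSpace ℝ (Fin a × Fin b)) :
      inner ℝ (rowVec (A * unrowVec v * K)) T = inner ℝ v (rowVec (Aᵀ * unrowVec T * Kᵀ)) := by
    rw [EuclideanSpace.inner_eq_star_dotProduct, EuclideanSpace.inner_eq_star_dotProduct,
      star_trivial, star_trivial, ← rowVec_unrowVec T, rowVec_dotProduct,
      ← rowVec_unrowVec v, rowVec_dotProduct]
    simp only [rowVec_unrowVec, transpose_mul, transpose_transpose]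
    rw [trace_mul_comm]
    simp only [Matrix.mul_assoc]
    rw [trace_mul_comm]
    simp only [Matrix.mul_assoc]
    rw [trace_mul_comm]
    simp only [Matrix.mul_assoc]
  have hmap : charFun ((matrixNormal Q S).map fun v => rowVec (A * unrowVec v * K)) T =
      charFun (matrixNormal Q S) (rowVec (Aᵀ * unrowVec T * Kᵀ)) := by
    rw [charFun_apply, integral_map hcont.measurable.aemeasurable
      (Measurable.aestronglyMeasurable (by fun_prop)), charFun_apply]
    simp only [hinner]
  rw [hmap, matrixNormal, matrixNormal, charFun_multivariateGaussian (hQ.kronecker hS),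
    charFun_multivariateGaussian (hQ'.kronecker hS')]
  have hquad : (rowVec (Aᵀ * unrowVec T * Kᵀ)).ofLp ⬝ᵥ
      (Q ⊗ₖ S) *ᵥ (rowVec (Aᵀ * unrowVec T * Kᵀ)).ofLp =
      T.ofLp ⬝ᵥ ((A * Q * Aᵀ) ⊗ₖ (Kᵀ * S * K)) *ᵥ T.ofLp := by
    rw [← rowVec_unrowVec T]
    simp only [unrowVec_rowVec, kronecker_mulVec_rowVec, rowVec_dotProduct, transpose_mul,
      transpose_transpose]
    simp only [Matrix.mul_assoc]
    rw [trace_mul_comm]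
    simp only [Matrix.mul_assoc]
  rw [hquad]
  simp

end MatrixNormal

/-! ### Matrix limits and uniform negligibility -/

section Limits

lemma tendsto_matrix_inv {ι : Type*} {l : Filter ι} {d : ℕ} {A : ι → Matrix (Fin d) (Fin d) ℝ}
    {B : Matrix (Fin d) (Fin d) ℝ} (h : Tendsto A l (𝓝 B)) (hB : IsUnit B.det) :
    Tendsto (fun x => (A x)⁻¹) l (𝓝 B⁻¹) := by
  refine (continuousAt_matrix_inv B ?_).tendsto.comp h
  rw [Ring.inverse_eq_inv']
  exact continuousAt_inv₀ hB.ne_zero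

lemma eventually_isUnit_det {ι : Type*} {l : Filter ι} {d : ℕ}
    {A : ι → Matrix (Fin d) (Fin d) ℝ} {B : Matrix (Fin d) (Fin d) ℝ} (h : Tendsto A l (𝓝 B))
    (hB : IsUnit B.det) : ∀ᶠ x in l, IsUnit (A x).det := by
  have := ((continuous_id.matrix_det.tendsto B).comp h).eventually_ne hB.ne_zero
  exact this.mono fun x hx => isUnit_iff_ne_zero.2 hx

lemma isUnit_det_of_smul {d : ℕ} {c : ℝ} {A : Matrix (Fin d) (Fin d) ℝ}
    (h : IsUnit (c • A).det) : IsUnit A.det := by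
  rw [det_smul] at h
  exact isUnit_of_mul_isUnit_right h

lemma tendsto_matrix_mul {ι : Type*} {l : Filter ι} {a b c : ℕ}
    {A : ι → Matrix (Fin a) (Fin b) ℝ} {A' : Matrix (Fin a) (Fin b) ℝ}
    {B : ι → Matrix (Fin b) (Fin c) ℝ} {B' : Matrix (Fin b) (Fin c) ℝ}
    (hA : Tendsto A l (𝓝 A')) (hB : Tendsto B l (𝓝 B')) :
    Tendsto (fun x => A x * B x) l (𝓝 (A' * B')) :=
  ((continuous_fst.matrix_mul continuous_snd).tendsto (A', B')).comp (hA.prodMk_nhds hB)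

lemma tendsto_matrix_transpose {ι : Type*} {l : Filter ι} {a b : ℕ}
    {A : ι → Matrix (Fin a) (Fin b) ℝ} {A' : Matrix (Fin a) (Fin b) ℝ} (hA : Tendsto A l (𝓝 A')) :
    Tendsto (fun x => (A x)ᵀ) l (𝓝 A'ᵀ) :=
  (continuous_id.matrix_transpose.tendsto A').comp hA

lemma tendsto_matrix_iff {ι : Type*} {l : Filter ι} {a b : ℕ}
    {A : ι → Matrix (Fin a) (Fin b) ℝ} {A' : Matrix (Fin a) (Fin b) ℝ} :
    Tendsto A l (𝓝 A') ↔ ∀ i j, Tendsto (fun x => A x i j) l (𝓝 (A' i j)) :=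
  tendsto_pi_nhds.trans (forall_congr' fun _ => tendsto_pi_nhds)

/-- If the averages of a sequence converge, its terms are uniformly negligible with respect to the
number of terms. -/
lemma eventually_forall_lt_mul_of_tendsto_average {s : ℕ → ℝ} {r : ℝ}
    (h : Tendsto (fun n : ℕ => (n : ℝ)⁻¹ * ∑ j ∈ Finset.range n, s j) atTop (𝓝 r)) {δ : ℝ}
    (hδ : 0 < δ) : ∀ᶠ n : ℕ in atTop, ∀ j < n, s j < δ * n := by
  -- `s n / (n + 1)` is the average of the first `n + 1` terms minus `n / (n + 1)` times the average
  -- of the first `n`; both tend to `r`.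
  have h1 : Tendsto (fun n : ℕ => s n / ((n : ℝ) + 1)) atTop (𝓝 0) := by
    have h2 : Tendsto (fun n : ℕ => (n : ℝ) / ((n : ℝ) + 1)) atTop (𝓝 1) :=
      tendsto_natCast_div_add_atTop 1
    have h3 := ((tendsto_add_atTop_iff_nat 1).2 h).sub (h.mul h2)
    rw [mul_one, sub_self] at h3
    refine h3.congr' ?_
    filter_upwards [eventually_gt_atTop 0] with n hn
    have : (n : ℝ) ≠ 0 := by positivity
    rw [Finset.sum_range_succ]
    push_cast
    field_simp
    ring
  obtain ⟨N, hN⟩ := eventually_atTop.1 (h1.eventually_lt_const hδ)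
  -- The finitely many terms before `N` are beaten by large `n`; from `N` on, `s j < δ * (j + 1) ≤ δ
  -- * n`.
  have h4 : ∀ᶠ n : ℕ in atTop, ∀ j ∈ Finset.range N, s j < δ * n := by
    rw [Finset.eventually_all]
    intro j _
    exact (tendsto_natCast_atTop_atTop.const_mul_atTop hδ).eventually_gt_atTop (s j)
  filter_upwards [h4] with n hn j hj
  rcases lt_or_ge j N with hjN | hjN
  · exact hn j (Finset.mem_range.2 hjN)
  · have h5 := hN j hjN
    rw [div_lt_iff₀ (by positivity)] at h5
    have : (j : ℝ) + 1 ≤ n := by exact_mod_cast hj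
    nlinarith

lemma firstRows_transpose_mul_apply {a b : ℕ} (x : ℕ → Fin a → ℝ) (y : ℕ → Fin b → ℝ) (n : ℕ)
    (i : Fin a) (j : Fin b) :
    ((firstRows x n)ᵀ * firstRows y n) i j = ∑ l ∈ Finset.range n, x l i * y l j := by
  rw [mul_apply, Finset.sum_range]
  rfl

lemma rowVec_smul_firstRows_mul {a b : ℕ} (x : ℕ → Fin a → ℝ) (y : ℕ → Fin b → ℝ) (n : ℕ) (c : ℝ) :
    rowVec (c • ((firstRows x n)ᵀ * firstRows y n)) =
      ∑ j ∈ Finset.range n, rowVec (vecMulVec (c • x j) (y j)) := by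
  ext ⟨i, j⟩
  simp only [rowVec, Matrix.smul_apply, firstRows_transpose_mul_apply, vecMulVec_apply, Pi.smul_apply,
    WithLp.ofLp_sum, Finset.sum_apply, smul_eq_mul, Finset.mul_sum, mul_assoc]

end Limits

/-! ### Measurability of the estimators -/

section Measurability

variable {Ω : Type*} [MeasurableSpace Ω] {P : Measure Ω}

/-- Entrywise almost everywhere measurability of a random matrix. -/
def AEMeasurableEntries {a b : ℕ} (M : Ω → Matrix (Fin a) (Fin b) ℝ) (P : Measure Ω) : Prop :=
  ∀ i j, AEMeasurable (fun ω => M ω i j) P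

namespace AEMeasurableEntries

variable {a b c : ℕ} {M M' : Ω → Matrix (Fin a) (Fin b) ℝ} {N : Ω → Matrix (Fin b) (Fin c) ℝ}

lemma const (M : Matrix (Fin a) (Fin b) ℝ) : AEMeasurableEntries (fun _ : Ω => M) P :=
  fun _ _ => aemeasurable_const

lemma add (h : AEMeasurableEntries M P) (h' : AEMeasurableEntries M' P) :
    AEMeasurableEntries (fun ω => M ω + M' ω) P := fun i j => (h i j).add (h' i j)

lemma sub (h : AEMeasurableEntries M P) (h' : AEMeasurableEntries M' P) :
    AEMeasurableEntries (fun ω => M ω - M' ω) P := fun i j => (h i j).sub (h' i j)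

lemma smul (h : AEMeasurableEntries M P) (r : ℝ) : AEMeasurableEntries (fun ω => r • M ω) P :=
  fun i j => (h i j).const_mul r

lemma transpose (h : AEMeasurableEntries M P) : AEMeasurableEntries (fun ω => (M ω)ᵀ) P :=
  fun i j => h j i

lemma mul (h : AEMeasurableEntries M P) (h' : AEMeasurableEntries N P) :
    AEMeasurableEntries (fun ω => M ω * N ω) P := fun i j => by
  simp only [mul_apply]
  exact Finset.aemeasurable_fun_sum _ fun l _ => (h i l).mul (h' l j)

lemma det {M : Ω → Matrix (Fin a) (Fin a) ℝ} (h : AEMeasurableEntries M P) :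
    AEMeasurable (fun ω => (M ω).det) P := by
  simp only [det_apply']
  exact Finset.aemeasurable_fun_sum _ fun σ _ =>
    (Finset.aemeasurable_fun_prod _ fun l _ => h _ _).const_mul _

/-- The formula by adjugate and inverse determinant also gives the value `0` at singular matrices,
so invertibility is not needed. -/
lemma inv {M : Ω → Matrix (Fin a) (Fin a) ℝ} (h : AEMeasurableEntries M P) :
    AEMeasurableEntries (fun ω => (M ω)⁻¹) P := fun i j => by
  simp only [inv_def, Matrix.smul_apply, Ring.inverse_eq_inv', smul_eq_mul, adjugate_apply]
  refine h.det.inv.mul (det (M := fun ω => (M ω).updateRow j (Pi.single i 1)) fun l l' => ?_)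
  rcases eq_or_ne l j with rfl | hl
  · simp only [updateRow_self]
    exact aemeasurable_const
  · simp only [updateRow_ne hl]
    exact h l l'

lemma rowVec (h : AEMeasurableEntries M P) : AEMeasurable (fun ω => rowVec (M ω)) P :=
  (WithLp.measurable_toLp 2 _).comp_aemeasurable (aemeasurable_pi_iff.2 fun ij => h ij.1 ij.2)

lemma sigmaHat {n p k : ℕ} {m : Fin k → ℕ} (X : ∀ i, Matrix (Fin n) (Fin (m i)) ℝ)
    {Y : Ω → Matrix (Fin n) (Fin p) ℝ} (h : AEMeasurableEntries Y P) :
    AEMeasurableEntries (fun ω => sigmaHat X (Y ω)) P :=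
  (h.transpose.mul (const _)).mul h

lemma glsFactor {p d : ℕ} {S : Ω → Matrix (Fin p) (Fin p) ℝ} (h : AEMeasurableEntries S P)
    (Z : Matrix (Fin p) (Fin d) ℝ) : AEMeasurableEntries (fun ω => glsFactor (S ω) Z) P :=
  (h.inv.mul (const Z)).mul (((const Zᵀ).mul h.inv).mul (const Z)).inv

lemma thetaHat {n p k : ℕ} {m q : Fin k → ℕ} (X : ∀ i, Matrix (Fin n) (Fin (m i)) ℝ)
    (Z : ∀ i, Matrix (Fin p) (Fin (q i)) ℝ) {Y : Ω → Matrix (Fin n) (Fin p) ℝ}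
    (h : AEMeasurableEntries Y P) (i : Fin k) :
    AEMeasurableEntries (fun ω => thetaHat X Z (Y ω) i) P := by
  have hS := (h.sigmaHat X).inv
  exact ((((const _).mul h).mul (((hS.mul (const _)).mul
    (((const _).mul hS).mul (const _)).inv).mul (const _))).mul (const _)).mul (const _)

end AEMeasurableEntries

end Measurability

/-! ### Consistency of the covariance estimator and normality of the cross products -/

section Consistency

variable {Ω : Type*} [MeasurableSpace Ω] {P : Measure Ω} [IsProbabilityMeasure P] {p : ℕ}
  {ε : ℕ → Ω → Fin p → ℝ} {S : Matrix (Fin p) (Fin p) ℝ}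

lemma tendsto_inProb_gram_errors (hindep : iIndepFun ε P)
    (hident : ∀ j, IdentDistrib (ε j) (ε 0) P P) (hL2 : ∀ a, MemLp (fun ω => ε 0 ω a) 2 P)
    (hcov : ∀ a b, ∫ ω, ε 0 ω a * ε 0 ω b ∂P = S a b) :
    Tendsto (fun x : ℕ × Ω => (x.1 : ℝ)⁻¹ •
      ((firstRows (fun j => ε j x.2) x.1)ᵀ * firstRows (fun j => ε j x.2) x.1))
      (inProb P) (𝓝 S) := by
  rw [tendsto_matrix_iff]
  intro a b
  have hm : Measurable fun v : Fin p → ℝ => v a * v b := by fun_prop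
  have h := tendsto_inProb_average (ξ := fun j ω => ε j ω a * ε j ω b)
    (hindep.comp (fun _ v => v a * v b) fun _ => hm) (fun j => (hident j).comp hm)
    ((hL2 a).integrable_mul (hL2 b))
  rw [hcov] at h
  simpa only [Matrix.smul_apply, firstRows_transpose_mul_apply, smul_eq_mul] using h

/-- Entrywise a weighted sum whose squared weights add up to `n⁻¹` times a diagonal entry of the
normalized Gram matrix, hence tend to `0`. -/
lemma tendsto_inProb_cross_errors (hindep : iIndepFun ε P)
    (hident : ∀ j, IdentDistrib (ε j) (ε 0) P P) (hL2 : ∀ a, MemLp (fun ω => ε 0 ω a) 2 P)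
    (hmean : ∀ a, ∫ ω, ε 0 ω a ∂P = 0) {d : ℕ} {x : ℕ → Fin d → ℝ}
    {R : Matrix (Fin d) (Fin d) ℝ}
    (hlim : Tendsto (fun n : ℕ => (n : ℝ)⁻¹ • ((firstRows x n)ᵀ * firstRows x n)) atTop (𝓝 R)) :
    Tendsto (fun y : ℕ × Ω => (y.1 : ℝ)⁻¹ •
      ((firstRows x y.1)ᵀ * firstRows (fun j => ε j y.2) y.1)) (inProb P) (𝓝 0) := by
  rw [tendsto_matrix_iff]
  intro a b
  have hm : Measurable fun v : Fin p → ℝ => v b := by fun_prop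
  have hc : Tendsto (fun n : ℕ => ∑ j ∈ Finset.range n, ((n : ℝ)⁻¹ * x j a) ^ 2) atTop (𝓝 0) := by
    have h := tendsto_inv_atTop_nhds_zero_nat (𝕜 := ℝ).mul (tendsto_matrix_iff.1 hlim a a)
    rw [zero_mul] at h
    refine h.congr fun n => ?_
    simp only [Matrix.smul_apply, firstRows_transpose_mul_apply, smul_eq_mul, Finset.mul_sum]
    exact Finset.sum_congr rfl fun j _ => by ring
  have h := tendsto_inProb_sum_weights (ξ := fun j ω => ε j ω b)
    (hindep.comp (fun _ v => v b) fun _ => hm) (fun j => (hident j).comp hm) (hL2 b) (hmean b)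
    (c := fun n j => (n : ℝ)⁻¹ * x j a) hc
  simpa only [Matrix.smul_apply, firstRows_transpose_mul_apply, smul_eq_mul, Finset.mul_sum,
    mul_assoc, Matrix.zero_apply] using h

variable {k : ℕ} {m : Fin k → ℕ} {x : ∀ i, ℕ → Fin (m i) → ℝ}

/-- The ranks are bounded by the fixed numbers of columns, so dividing by `r` or by `n` is
asymptotically the same. -/
lemma tendsto_degrees_of_freedom :
    Tendsto (fun n : ℕ => ((n : ℝ) - ∑ i, ((firstRows (x i) n).rank : ℝ))⁻¹ * n) atTop (𝓝 1) := by
  have h1 : Tendsto (fun n : ℕ => (∑ i, ((firstRows (x i) n).rank : ℝ)) / n) atTop (𝓝 0) := by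
    refine squeeze_zero (fun n => by positivity) (fun n => ?_)
      (tendsto_const_div_atTop_nhds_zero_nat (∑ i, (m i : ℝ)))
    gcongr with i
    exact rank_le_width _
  have h2 := (tendsto_const_nhds (x := (1 : ℝ)).sub h1).inv₀ (by simp)
  simp only [sub_zero, inv_one] at h2
  refine h2.congr' ?_
  filter_upwards [eventually_gt_atTop 0] with n hn
  have : (n : ℝ) ≠ 0 := by positivity
  rw [one_sub_div this, inv_div, div_eq_inv_mul]

lemma eventually_isUnit_gram {R : ∀ l, Matrix (Fin (m l)) (Fin (m l)) ℝ} (hR : ∀ l, (R l).PosDef)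
    (hlim : ∀ l, Tendsto (fun n : ℕ => (n : ℝ)⁻¹ • ((firstRows (x l) n)ᵀ * firstRows (x l) n))
      atTop (𝓝 (R l))) :
    ∀ᶠ n in atTop, ∀ l, IsUnit ((firstRows (x l) n)ᵀ * firstRows (x l) n).det := by
  rw [eventually_all]
  intro l
  exact (eventually_isUnit_det (hlim l) ((isUnit_iff_isUnit_det _).1 (hR l).isUnit)).mono
    fun n hn => isUnit_det_of_smul hn

/-- The first-stage covariance estimator is consistent. -/
lemma tendsto_inProb_sigmaHat (hindep : iIndepFun ε P)
    (hident : ∀ j, IdentDistrib (ε j) (ε 0) P P) (hL2 : ∀ a, MemLp (fun ω => ε 0 ω a) 2 P)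
    (hmean : ∀ a, ∫ ω, ε 0 ω a ∂P = 0) (hcov : ∀ a b, ∫ ω, ε 0 ω a * ε 0 ω b ∂P = S a b)
    {R : ∀ l, Matrix (Fin (m l)) (Fin (m l)) ℝ} (hR : ∀ l, (R l).PosDef)
    (hlim : ∀ l, Tendsto (fun n : ℕ => (n : ℝ)⁻¹ • ((firstRows (x l) n)ᵀ * firstRows (x l) n))
      atTop (𝓝 (R l))) :
    Tendsto (fun y : ℕ × Ω => sigmaHat (fun l => firstRows (x l) y.1)
      (firstRows (fun j => ε j y.2) y.1)) (inProb P) (𝓝 S) := by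
  have hU (l) := tendsto_inProb_cross_errors hindep hident hL2 hmean (hlim l)
  have hA (l) : Tendsto (fun y : ℕ × Ω => ((y.1 : ℝ)⁻¹ •
      ((firstRows (x l) y.1)ᵀ * firstRows (x l) y.1))⁻¹) (inProb P) (𝓝 (R l)⁻¹) :=
    (tendsto_matrix_inv (hlim l) ((isUnit_iff_isUnit_det _).1 (hR l).isUnit)).comp
      tendsto_fst_inProb
  -- Each projection term has the limit `0' * (R l)⁻¹ * 0`, so only the Gram matrix of the errors
  -- contributes.
  have h := ((tendsto_degrees_of_freedom (x := x)).comp (tendsto_fst_inProb (P := P))).smul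
    ((tendsto_inProb_gram_errors hindep hident hL2 hcov).sub (tendsto_finsetSum Finset.univ
      fun l _ => tendsto_matrix_mul (tendsto_matrix_mul (tendsto_matrix_transpose (hU l)) (hA l))
        (hU l)))
  simp only [Matrix.mul_zero, Finset.sum_const_zero, sub_zero, one_smul] at h
  refine h.congr' ?_
  filter_upwards [tendsto_fst_inProb.eventually (eventually_isUnit_gram hR hlim),
    tendsto_fst_inProb.eventually (eventually_ne_atTop 0)] with y hy hy0
  exact (sigmaHat_eq hy0 hy _).symm

lemma tendsto_glsFactor {ι : Type*} {l : Filter ι} {d : ℕ} {T : ι → Matrix (Fin p) (Fin p) ℝ}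
    (hT : Tendsto T l (𝓝 S)) (hS : S.PosDef) {Z : Matrix (Fin p) (Fin d) ℝ} (hZ : Z.rank = d) :
    Tendsto (fun y => glsFactor (T y) Z) l (𝓝 (glsFactor S Z)) := by
  have h := tendsto_matrix_mul (tendsto_matrix_inv hT ((isUnit_iff_isUnit_det _).1 hS.isUnit))
    (tendsto_const_nhds (x := Z))
  have h' := tendsto_matrix_mul (tendsto_const_nhds (x := Zᵀ)) h
  simp only [← Matrix.mul_assoc] at h'
  exact tendsto_matrix_mul h (tendsto_matrix_inv h' (isUnit_gram hZ hS.inv))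

lemma eventually_isUnit_weighted_gram {ι : Type*} {l : Filter ι} {d : ℕ}
    {T : ι → Matrix (Fin p) (Fin p) ℝ} (hT : Tendsto T l (𝓝 S)) (hS : S.PosDef)
    {Z : Matrix (Fin p) (Fin d) ℝ} (hZ : Z.rank = d) :
    ∀ᶠ y in l, IsUnit (Zᵀ * (T y)⁻¹ * Z).det :=
  eventually_isUnit_det (tendsto_matrix_mul (tendsto_matrix_mul tendsto_const_nhds
    (tendsto_matrix_inv hT ((isUnit_iff_isUnit_det _).1 hS.isUnit))) tendsto_const_nhds)
    (isUnit_gram hZ hS.inv)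

/-- `S` cancels one of the two inverses in the sandwich, and the `Zᵀ * S⁻¹ * Z` that appears cancels
one of the two outer inverses. -/
lemma glsFactor_covariance {d : ℕ} (hS : S.PosDef) {Z : Matrix (Fin p) (Fin d) ℝ}
    (hZ : Z.rank = d) : (glsFactor S Z)ᵀ * S * glsFactor S Z = (Zᵀ * S⁻¹ * Z)⁻¹ := by
  have hSu := (isUnit_iff_isUnit_det _).1 hS.isUnit
  have hSt : Sᵀ = S := by
    simpa [conjTranspose_eq_transpose_of_trivial] using hS.isHermitian.eq
  have hG := isUnit_gram hZ hS.inv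
  have h1 : S * glsFactor S Z = Z * (Zᵀ * S⁻¹ * Z)⁻¹ := by
    rw [glsFactor, Matrix.mul_assoc S⁻¹, ← Matrix.mul_assoc S, Matrix.mul_nonsing_inv _ hSu,
      Matrix.one_mul]
  have h2 : (glsFactor S Z)ᵀ = (Zᵀ * S⁻¹ * Z)⁻¹ * (Zᵀ * S⁻¹) := by
    simp only [glsFactor, transpose_mul, transpose_nonsing_inv, hSt, transpose_transpose,
      Matrix.mul_assoc]
  rw [Matrix.mul_assoc, h1, h2, Matrix.mul_assoc, ← Matrix.mul_assoc (Zᵀ * S⁻¹) Z,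
    Matrix.mul_nonsing_inv _ hG, Matrix.mul_one]

/-- The normalized cross products of the design and the errors are asymptotically normal. -/
lemma tendstoInDistribution_cross_errors (hindep : iIndepFun ε P)
    (hident : ∀ j, IdentDistrib (ε j) (ε 0) P P) (hL2 : ∀ a, MemLp (fun ω => ε 0 ω a) 2 P)
    (hmean : ∀ a, ∫ ω, ε 0 ω a ∂P = 0) (hcov : ∀ a b, ∫ ω, ε 0 ω a * ε 0 ω b ∂P = S a b)
    (hS : S.PosSemidef) {d : ℕ} {x : ℕ → Fin d → ℝ} {R : Matrix (Fin d) (Fin d) ℝ}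
    (hR : R.PosSemidef)
    (hlim : Tendsto (fun n : ℕ => (n : ℝ)⁻¹ • ((firstRows x n)ᵀ * firstRows x n)) atTop (𝓝 R)) :
    TendstoInDistribution (fun (n : ℕ) ω => rowVec ((√n)⁻¹ •
      ((firstRows x n)ᵀ * firstRows (fun j => ε j ω) n))) atTop id (fun _ => P)
      (matrixNormal R S) := by
  simp only [rowVec_smul_firstRows_mul]
  have hsq (n : ℕ) : (√n)⁻¹ * (√n)⁻¹ = (n : ℝ)⁻¹ := by
    rw [← mul_inv, Real.mul_self_sqrt n.cast_nonneg]
  refine tendstoInDistribution_weighted_sum (c := fun n j => (√n)⁻¹ • x j) hindep hident hL2 hmean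
    hcov hS hR (hlim.congr fun n => ?_) fun δ hδ => ?_
  · ext a b
    simp only [Matrix.smul_apply, firstRows_transpose_mul_apply, smul_eq_mul, of_apply, Pi.smul_apply,
      Finset.mul_sum, ← hsq]
    exact Finset.sum_congr rfl fun j _ => by ring
  -- Negligibility of the weights `x j / √n`: the averages of `x j a ^ 2` converge, so each square
  -- is eventually below `δ ^ 2 * n`, uniformly in `j < n`.
  · have h : ∀ a, ∀ᶠ n : ℕ in atTop, ∀ j < n, x j a ^ 2 < δ ^ 2 * n := by
      intro a
      refine eventually_forall_lt_mul_of_tendsto_average (r := R a a) ?_ (by positivity)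
      refine (tendsto_matrix_iff.1 hlim a a).congr fun n => ?_
      simp only [Matrix.smul_apply, firstRows_transpose_mul_apply, smul_eq_mul, sq]
    filter_upwards [eventually_all.2 h, eventually_gt_atTop 0] with n hn hn0 j hj
    rw [pi_norm_lt_iff hδ]
    intro a
    have hpos : 0 < √(n : ℝ) := Real.sqrt_pos.2 (by exact_mod_cast hn0)
    rw [Pi.smul_apply, smul_eq_mul, norm_mul, norm_inv, Real.norm_of_nonneg hpos.le,
      inv_mul_lt_iff₀ hpos, Real.norm_eq_abs]
    refine abs_lt_of_sq_lt_sq ?_ (by positivity)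
    rw [mul_pow, Real.sq_sqrt n.cast_nonneg, mul_comm]
    exact hn a j hj

end Consistency

/-! ### Slutsky's theorem and the conclusion -/

lemma tendstoInDistribution_id_of_map_eq {Ω E E' : Type*} [MeasurableSpace Ω] {P : Measure Ω}
    [IsProbabilityMeasure P] [MeasurableSpace E'] {μ : Measure E'} [IsProbabilityMeasure μ]
    [TopologicalSpace E] [MeasurableSpace E] [OpensMeasurableSpace E] {ν : Measure E}
    [IsProbabilityMeasure ν] {X : ℕ → Ω → E} {Z : E' → E}
    (h : TendstoInDistribution X atTop Z (fun _ => P) μ) (hν : μ.map Z = ν) :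
    TendstoInDistribution X atTop id (fun _ => P) ν := by
  refine ⟨h.forall_aemeasurable, aemeasurable_id, ?_⟩
  have e : (⟨ν.map id, Measure.isProbabilityMeasure_map aemeasurable_id⟩ : ProbabilityMeasure E) =
      ⟨μ.map Z, Measure.isProbabilityMeasure_map h.aemeasurable_limit⟩ := by
    apply Subtype.ext
    simp [hν]
  rw [e]
  exact h.tendsto

/-- Slutsky's theorem for products `A_n V_n K_n` of random matrices. -/
lemma tendstoInDistribution_rowVec_mul_mul {Ω : Type*} [MeasurableSpace Ω] {P : Measure Ω}
    [IsProbabilityMeasure P] {a b c d : ℕ} {V : ℕ → Ω → Matrix (Fin a) (Fin b) ℝ}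
    {Q : Matrix (Fin a) (Fin a) ℝ} {S : Matrix (Fin b) (Fin b) ℝ} (hQ : Q.PosSemidef)
    (hS : S.PosSemidef)
    (hV : TendstoInDistribution (fun n ω => rowVec (V n ω)) atTop id (fun _ => P)
      (matrixNormal Q S))
    {A : ℕ → Matrix (Fin c) (Fin a) ℝ} {A' : Matrix (Fin c) (Fin a) ℝ}
    (hA : Tendsto A atTop (𝓝 A')) {K : ℕ → Ω → Matrix (Fin b) (Fin d) ℝ}
    {K' : Matrix (Fin b) (Fin d) ℝ} (hK : Tendsto (fun y : ℕ × Ω => K y.1 y.2) (inProb P) (𝓝 K'))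
    (hKm : ∀ n, AEMeasurableEntries (K n) P) :
    TendstoInDistribution (fun n ω => rowVec (A n * V n ω * K n ω)) atTop id (fun _ => P)
      (matrixNormal (A' * Q * A'ᵀ) (K'ᵀ * S * K')) := by
  -- The outer factors form a single random element converging in probability to a constant, so
  -- Slutsky's theorem applies to the continuous triple product.
  set C : ℕ → Ω → EuclideanSpace ℝ (Fin c × Fin a) × EuclideanSpace ℝ (Fin b × Fin d) :=
    fun n ω => (rowVec (A n), rowVec (K n ω)) with hC
  have hClim : TendstoInMeasure P C atTop fun _ => (rowVec A', rowVec K') := by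
    rw [← tendsto_inProb_iff_tendstoInMeasure]
    exact (((continuous_rowVec.tendsto A').comp hA).comp tendsto_fst_inProb).prodMk_nhds
      ((continuous_rowVec.tendsto K').comp hK)
  have hg : Continuous fun z : EuclideanSpace ℝ (Fin a × Fin b) ×
      EuclideanSpace ℝ (Fin c × Fin a) × EuclideanSpace ℝ (Fin b × Fin d) =>
      rowVec (unrowVec z.2.1 * unrowVec z.1 * unrowVec z.2.2) :=
    continuous_rowVec.comp
      (((continuous_unrowVec.comp (continuous_fst.comp continuous_snd)).matrix_mul
        (continuous_unrowVec.comp continuous_fst)).matrix_mul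
        (continuous_unrowVec.comp (continuous_snd.comp continuous_snd)))
  have h := hV.continuous_comp_prodMk_of_tendstoInMeasure_const hg hClim
    fun n => aemeasurable_const.prodMk (hKm n).rowVec
  exact tendstoInDistribution_id_of_map_eq h (map_matrixNormal hQ hS A' K')

end GrowthCurve

theorem theorem4p2 {Ω : Type*} [MeasurableSpace Ω] (P : Measure Ω) [IsProbabilityMeasure P]
    {p k : ℕ} {m q : Fin k → ℕ}
    -- the rows of the design matrices, the profile matrices and the coefficients
    (x : ∀ i, ℕ → Fin (m i) → ℝ) (Z : ∀ i, Matrix (Fin p) (Fin (q i)) ℝ)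
    (Θ : ∀ i, Matrix (Fin (m i)) (Fin (q i)) ℝ)
    (hZ : ∀ i, (Z i).rank = q i)
    (hX : ∀ᶠ n in atTop, GrowthCurve.OrthogonalDesign p fun i => GrowthCurve.firstRows (x i) n)
    -- the rows of the error matrix
    (ε : ℕ → Ω → Fin p → ℝ) (S : Matrix (Fin p) (Fin p) ℝ)
    (hindep : iIndepFun ε P) (hident : ∀ j, IdentDistrib (ε j) (ε 0) P P)
    (hL2 : ∀ a, MemLp (fun ω => ε 0 ω a) 2 P)
    (hmean : ∀ a, ∫ ω, ε 0 ω a ∂P = 0)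
    (hcov : ∀ a b, ∫ ω, ε 0 ω a * ε 0 ω b ∂P = S a b) (hS : S.PosDef)
    -- the limits of the normalized Gram matrices
    (R : ∀ l, Matrix (Fin (m l)) (Fin (m l)) ℝ) (hR : ∀ l, (R l).PosDef)
    (hlim : ∀ l, Tendsto (fun n : ℕ => (n : ℝ)⁻¹ •
      ((GrowthCurve.firstRows (x l) n)ᵀ * GrowthCurve.firstRows (x l) n)) atTop (𝓝 (R l)))
    -- the observations
    (Y : ∀ n : ℕ, Ω → Matrix (Fin n) (Fin p) ℝ)
    (hY : ∀ n ω, Y n ω = GrowthCurve.meanStructure (fun i => GrowthCurve.firstRows (x i) n) Z Θ +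
      GrowthCurve.firstRows (fun j => ε j ω) n)
    (i : Fin k) :
    TendstoInDistribution
      (fun (n : ℕ) ω => GrowthCurve.rowVec (Real.sqrt n •
        (GrowthCurve.thetaHat (fun l => GrowthCurve.firstRows (x l) n) Z (Y n ω) i - Θ i)))
      atTop id (fun _ => P)
      (GrowthCurve.matrixNormal (R i)⁻¹ ((Z i)ᵀ * S⁻¹ * Z i)⁻¹) := by
  have hRu := (isUnit_iff_isUnit_det _).1 (hR i).isUnit
  have hRt : (R i)ᵀ = R i := by
    simpa [conjTranspose_eq_transpose_of_trivial] using (hR i).isHermitian.eq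
  have hEm (n : ℕ) :
      GrowthCurve.AEMeasurableEntries (fun ω => GrowthCurve.firstRows (fun j => ε j ω) n) P :=
    fun j a => (measurable_pi_apply a).comp_aemeasurable (hident j).aemeasurable_fst
  have hYm (n : ℕ) : GrowthCurve.AEMeasurableEntries (Y n) P := by
    rw [funext (hY n)]
    exact (GrowthCurve.AEMeasurableEntries.const _).add (hEm n)
  have hgram := GrowthCurve.eventually_isUnit_gram hR hlim
  have hcons : Tendsto (fun y : ℕ × Ω => GrowthCurve.sigmaHat
      (fun l => GrowthCurve.firstRows (x l) y.1) (Y y.1 y.2)) (GrowthCurve.inProb P) (𝓝 S) := by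
    refine (GrowthCurve.tendsto_inProb_sigmaHat hindep hident hL2 hmean hcov hR hlim).congr' ?_
    filter_upwards [GrowthCurve.tendsto_fst_inProb.eventually hgram,
      GrowthCurve.tendsto_fst_inProb.eventually hX] with y hy hyX
    rw [hY, GrowthCurve.sigmaHat_meanStructure_add hyX.orthogonal hy]
  have hmain := GrowthCurve.tendstoInDistribution_rowVec_mul_mul (hR i).posSemidef hS.posSemidef
    (GrowthCurve.tendstoInDistribution_cross_errors hindep hident hL2 hmean hcov hS.posSemidef
      (hR i).posSemidef (hlim i)) (GrowthCurve.tendsto_matrix_inv (hlim i) hRu)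
    (K := fun n ω => GrowthCurve.glsFactor (GrowthCurve.sigmaHat
      (fun l => GrowthCurve.firstRows (x l) n) (Y n ω)) (Z i))
    (GrowthCurve.tendsto_glsFactor hcons hS (hZ i))
    fun n => ((hYm n).sigmaHat _).glsFactor _
  -- The row covariance `R⁻¹ R R⁻¹'` reduces to `R⁻¹` by symmetry of `R`.
  rw [GrowthCurve.glsFactor_covariance hS (hZ i), transpose_nonsing_inv, hRt,
    Matrix.nonsing_inv_mul _ hRu, Matrix.one_mul] at hmain
  -- The product and the normalized estimation error coincide on events of probability tending to
  -- `1`, so their difference tends to `0` in probability, whatever values singular inverses take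
  -- elsewhere.
  refine tendstoInDistribution_of_tendstoInMeasure_sub _ _ hmain ?_ fun n =>
    ((((hYm n).thetaHat _ Z i).sub (GrowthCurve.AEMeasurableEntries.const (Θ i))).smul _).rowVec
  refine GrowthCurve.tendsto_inProb_iff_tendstoInMeasure.1 (tendsto_const_nhds.congr' ?_)
  filter_upwards [GrowthCurve.tendsto_fst_inProb.eventually hgram,
    GrowthCurve.tendsto_fst_inProb.eventually hX,
    GrowthCurve.tendsto_fst_inProb.eventually (eventually_ne_atTop 0),
    GrowthCurve.eventually_isUnit_weighted_gram hcons hS (hZ i)] with y hy hyX hy0 hyS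
  rw [hY] at hyS
  simp only [Pi.sub_apply]
  rw [hY, GrowthCurve.sqrt_smul_thetaHat_sub hy0 hyX.orthogonal Z Θ _ i (hy i) (hZ i) hyS, sub_self]
  exact WithLp.toLp_zero 2
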